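/- Let $n\ge1$, $N\ge0$, $M\ge 0$ be integers and let $K$ be a field of characteristic $0$ (for instance $\mathbb C$). **Fock space.** Let $q\in K^\times$ and let $\alpha:\mathbb Z/n\to K$ satisfy $\alpha(0)=1$ and $\alpha(a)\alpha(-a)=1$ for all $a$. Put $g(0)=-q^2$ and $g(a)=-q\,\alpha(a)$ for $a\neq0$. The metaplectic Fock space $\mathcal F_{q,\alpha}$ has as basis the normally ordered semi-infinite wedges $u_{m_1}\wedge u_{m_2}\wedge\cdots$ ($m_1>m_2>\cdots$ integers, $m_{i+1}=m_i-1$ for large $i$); other wedges are expanded in this basis by $u_m\wedge u_m=0$ and, for $l<m$, by $u_l\wedge u_m=-u_m\wedge u_l$ if $l\equiv m \bmod n$, and otherwise, with $0<i<n$, $m-i\equiv l \bmod n$, $$u_l\wedge u_m=g(l-m)\,u_m\wedge u_l+(q^2-1)\sum_{t\ge0}q^{2t}\bigl(u_{m-i-tn}\wedge u_{l+i+tn}+g(l-m)\,u_{m-(t+1)n}\wedge u_{l+(t+1)n}\bigr),$$ where only normally ordered wedges are kept in the sum. For $k\ge1$ let $J_k(u_{m_1}\wedge u_{m_2}\wedge\cdots)=\sum_{i}u_{m_1}\wedge\cdots\wedge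 u_{m_i-kn}\wedge u_{m_{i+1}}\wedge\cdots$, and $L_+(\theta)=\sum_{k\ge1}\sum_{j=1}^N\frac1k\theta_j^kJ_k$. For a partition $\lambda=(\lambda_1\ge\dots\ge\lambda_\ell\ge0)$ of length $\ell$ let $\lambda+\rho=(\lambda_1+\ell-1,\lambda_2+\ell-2,\dots,\lambda_\ell)$, and for a strict partition $\kappa$ of length $\ell$ let $|\kappa\rangle=u_{\kappa_1}\wedge\cdots\wedge u_{\kappa_\ell}\wedge u_{-1}\wedge u_{-2}\wedge\cdots$, with dual basis $\langle\kappa|$. For partitions $\lambda,\mu$ of the same length, the supersymmetric LLT polynomial (for the fixed twist $\alpha$) is $$\mathcal G_{\lambda/\mu}(\theta|\pi;q)=\langle\mu+\rho|\,e^{L_+(\theta)-L_+(\pi)}\,|\lambda+\rho\rangle\qquad\text{in }\mathcal F_{q,\alpha}.$$ **Models.** Let $x_i,y_i,A_i,B_i\in K^\times$ ($1\le i\le N$) and $f,h:\mathbb Z/n\to K^\times$. A horizontal edge carries the spin $+$ or a spin $-$ with a charge in $\mathbb Z/n$; a vertical edge carries $+$ or $-$. List the spins at a vertex as (left, top, right,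 bottom), a charge being written as a subscript. The model $\mathfrak S^q$ has the admissible vertices $a_1=(+,+,+,+)$, $a_2(a)=(-_{a+1},-,-_a,-)$, $b_1=(+,-,+,-)$, $b_2(a)=(-_{a+1},+,-_a,+)$, $c_1=(-_1,+,+,-)$, $c_2=(+,-,-_0,+)$, whose weights in row $i$ are $$A_i,\quad h(a)y_iA_iB_i,\quad A_iB_i,\quad f(a)x_iA_i,\quad (f(0)x_i+h(0)y_i)A_iB_i,\quad A_i .$$ The model $\mathfrak S^{*,q}$ has the admissible vertices $a_1=(+,+,+,+)$, $a_2(a)=(-_a,-,-_{a+1},-)$, $b_1=(+,-,+,-)$, $b_2(a)=(-_a,+,-_{a+1},+)$, $c_1=(+,+,-_1,-)$, $c_2=(-_0,-,+,+)$, whose weights in row $i$ are $$A_i^{-1},\quad f(a)x_iA_i^{-1}B_i^{-1},\quad A_i^{-1}B_i^{-1},\quad h(a)y_iA_i^{-1},\quad (f(0)x_i+h(0)y_i)A_i^{-1},\quad A_i^{-1}B_i^{-1}.$$ For strict partitions $\kappa,\nu$ with all parts at most $M$, both models have $N$ rows, columns $0,\dots,M$ from left to right, and $+$ on the left and right boundary.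 $\mathfrak S^q_{\kappa/\nu}$ has rows numbered from bottom to top, with $-$ exactly on the parts of $\kappa$ at the bottom and exactly on the parts of $\nu$ at the top; $\mathfrak S^{*,q}_{\kappa/\nu}$ has rows numbered from top to bottom, with $\kappa$ at the top and $\nu$ at the bottom. $Z$ is the sum over all admissible states of the product of the vertex weights. **Theorem.** Suppose that the weights of $\mathfrak S^q$ are generalized free fermionic, i.e. in every row $a_1a_2(0)+b_1b_2(0)=c_1c_2$ and $$\frac{a_1a_2(a)a_2(-a)}{b_1b_2(a)b_2(-a)}=-\frac{a_2(0)}{b_2(0)}\qquad\text{for all } a\not\equiv0 \bmod n$$ (equivalently, the weights of $\mathfrak S^{*,q}$ are so), and let $\mathcal F_{q,\alpha}$ be their Fock space, i.e. $\frac{a_1a_2(a)}{b_1b_2(a)}=g(a)$ in every row of $\mathfrak S^q$ for all $a\not\equiv0 \bmod n$. Put $F=\prod_{a}f(a)$ and $H=\prod_{a}h(a)$, products over $a\in\mathbb Z/n$. Then for all partitions $\lambda,\mu$ of length $\ell$ such that the parts of $\lambda+\rho$ and $\mu+\rho$ are at most $M$, $$Z(\mathfrak S^q_{\lambda+\rho/\mu+\rho})=\prod_{i=1}^NA_i^{M+1}B_i^{\ell}\cdot\mathcal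 G_{\lambda/\mu}(\theta|\pi;q),\qquad \theta_i=x_i^nF,\quad \pi_i=-\tfrac{h(0)}{f(0)}x_i^{n-1}y_iF,$$ $$Z(\mathfrak S^{*,q}_{\lambda+\rho/\mu+\rho})=\prod_{i=1}^NA_i^{-(M+1)}B_i^{-\ell}\cdot\mathcal G_{\lambda/\mu}(\eta|\tau;q^{-1}),\qquad \eta_i=y_i^nH,\quad \tau_i=-\tfrac{f(0)}{h(0)}y_i^{n-1}x_iH,$$ where both polynomials are taken with the same twist $\alpha$. -/

import Mathlib

open scoped BigOperators

/-! ## Metaplectic Fock spaces -/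

/-- The data of a shift-invariant twist of `q`-Fock space: the quantum parameter `q ≠ 0` and the
twist `α_{ij} = α (i - j)`, which satisfies `α_{ii} = 1` and `α_{ij} α_{ji} = 1`. -/
structure MetaplecticData (n : ℕ) (K : Type*) [Field K] where
  q : K
  q_ne_zero : q ≠ 0
  α : ZMod n → K
  α_zero : α 0 = 1
  α_mul_neg : ∀ a, α a * α (-a) = 1

namespace MetaplecticData

variable {n : ℕ} {K : Type*} [Field K]

/-- The function `g` on charges: `g(0) = -q²` and `g(a) = -q α(a)` for `a ≠ 0`. -/
def g (F : MetaplecticData n K) (a : ZMod n) : K :=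
  if a = 0 then -F.q ^ 2 else -F.q * F.α a

/-- The data with `q` replaced by `q⁻¹` (and the same twist `α`). -/
def inv (F : MetaplecticData n K) : MetaplecticData n K where
  q := F.q⁻¹
  q_ne_zero := inv_ne_zero F.q_ne_zero
  α := F.α
  α_zero := F.α_zero
  α_mul_neg := F.α_mul_neg

/-- `g_*(a) = g(-a)⁻¹`. -/
theorem inv_g (F : MetaplecticData n K) (a : ZMod n) : F.inv.g a = (F.g (-a))⁻¹ := by
  by_cases ha : a = 0
  · simp [g, inv, ha, inv_neg]
  · have h := eq_inv_of_mul_eq_one_left (F.α_mul_neg a)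
    simp [g, inv, ha, h, inv_neg, mul_comm]

/-- The right-hand side of the normal ordering relation for `u_l ∧ u_m`, `l < m`, where `U a b`
stands for `u_a ∧ u_b`:
* `-u_m ∧ u_l` if `l ≡ m mod n`;
* otherwise, with `0 < i < n`, `m - i ≡ l mod n`,
  `g(l-m) u_m∧u_l + (q²-1) (u_{m-i}∧u_{l+i} + g(l-m) u_{m-n}∧u_{l+n}
    + q² u_{m-n-i}∧u_{l+n+i} + q² g(l-m) u_{m-2n}∧u_{l+2n} + ⋯)`,
  where the sum continues as long as the wedges are normally ordered. -/
def normalOrder (F : MetaplecticData n K) {E : Type*} [AddCommGroup E] [Module K E]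
    (l m : ℤ) (U : ℤ → ℤ → E) : E :=
  let i : ℤ := (m - l) % n
  let γ : K := F.g ((l - m : ℤ) : ZMod n)
  if i = 0 then -U m l
  else
    γ • U m l + (F.q ^ 2 - 1) • ∑ t ∈ Finset.range (m - l).toNat, (F.q ^ 2) ^ t •
      ((if l + i + t * n < m - i - t * n then U (m - i - t * n) (l + i + t * n) else 0) +
        (if l + (t + 1) * n < m - (t + 1) * n then
          γ • U (m - (t + 1) * n) (l + (t + 1) * n) else 0))

end MetaplecticData

/-- A normally ordered semi-infinite wedge `u_{m 0} ∧ u_{m 1} ∧ u_{m 2} ∧ ⋯`: a strictly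
decreasing sequence of integers which eventually decreases by one at each step. -/
@[ext]
structure NormalWedge where
  m : ℕ → ℤ
  strictAnti : StrictAnti m
  eventually : ∃ R, ∀ i, R ≤ i → m (i + 1) = m i - 1

namespace NormalWedge

/-- Remove the first factor. -/
def tail (w : NormalWedge) : NormalWedge where
  m := fun i => w.m (i + 1)
  strictAnti := fun _ _ h => w.strictAnti (Nat.succ_lt_succ h)
  eventually := by
    obtain ⟨R, hR⟩ := w.eventually
    exact ⟨R, fun i hi => hR (i + 1) (by omega)⟩

/-- Put a larger factor in front. -/
def cons (j : ℤ) (w : NormalWedge) (h : w.m 0 < j) : NormalWedge where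
  m := fun i => Nat.casesOn i j w.m
  strictAnti := by
    refine strictAnti_nat_of_succ_lt fun i => ?_
    cases i with
    | zero => exact h
    | succ i => exact w.strictAnti (Nat.lt_succ_self i)
  eventually := by
    obtain ⟨R, hR⟩ := w.eventually
    refine ⟨R + 1, fun i hi => ?_⟩
    cases i with
    | zero => omega
    | succ i => exact hR i (by omega)

/-- The normally ordered wedge
`u_{κ 0} ∧ ⋯ ∧ u_{κ (ℓ-1)} ∧ u_{-1} ∧ u_{-2} ∧ ⋯` of a strict partition `κ` of length `ℓ`. -/
def ofStrict {ℓ : ℕ} (κ : Fin ℓ → ℕ) (hκ : StrictAnti κ) : NormalWedge where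
  m := fun i => if h : i < ℓ then (κ ⟨i, h⟩ : ℤ) else (ℓ : ℤ) - 1 - i
  strictAnti := by
    refine strictAnti_nat_of_succ_lt fun i => ?_
    by_cases h1 : i + 1 < ℓ
    · have h0 : i < ℓ := by omega
      have : κ ⟨i + 1, h1⟩ < κ ⟨i, h0⟩ := hκ (by simp [Fin.lt_def])
      simp only [h1, h0, dif_pos]
      exact_mod_cast this
    · by_cases h0 : i < ℓ
      · simp only [h1, h0, dif_pos, dif_neg, not_false_eq_true]
        push_cast
        omega
      · simp only [h1, h0, dif_neg, not_false_eq_true]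
        push_cast
        omega
  eventually := by
    refine ⟨ℓ, fun i hi => ?_⟩
    have h1 : ¬ i + 1 < ℓ := by omega
    have h0 : ¬ i < ℓ := by omega
    simp only [h1, h0, dif_neg, not_false_eq_true]
    push_cast
    ring

end NormalWedge

/-- The Fock space: the vector space with basis the normally ordered wedges. -/
abbrev FockSpace (K : Type*) [Field K] := NormalWedge →₀ K

namespace MetaplecticData

variable {n : ℕ} {K : Type*} [Field K]

/-- Normal ordering of `u_j ∧ w`, for `w` normally ordered.  If `j` exceeds the first index `m` of
`w`, then `u_j ∧ w` is normally ordered; if `j = m` it is zero; and if `j < m`, the normal ordering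
relation is applied to the first two factors `u_j ∧ u_m`, and the resulting wedges
`u_a ∧ (u_b ∧ w.tail)` are normally ordered from the right.  Each step decreases `m - j`, so that
`m - j` recursion steps (the first argument) suffice. -/
noncomputable def insertAux (F : MetaplecticData n K) : ℕ → ℤ → NormalWedge → FockSpace K
  | 0, j, w => if h : w.m 0 < j then Finsupp.single (w.cons j h) 1 else 0
  | d + 1, j, w =>
      if h : w.m 0 < j then Finsupp.single (w.cons j h) 1
      else if j = w.m 0 then 0
      else F.normalOrder j (w.m 0) fun a b =>
        Finsupp.linearCombination K (insertAux F d a) (insertAux F d b w.tail)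

/-- The operator `u_j ∧ ·` on the Fock space. -/
noncomputable def wedge (F : MetaplecticData n K) (j : ℤ) : FockSpace K →ₗ[K] FockSpace K :=
  Finsupp.linearCombination K fun w => F.insertAux (w.m 0 - j).toNat j w

/-- The wedge `u_{m 0} ∧ ⋯ ∧ u_{m (i-1)} ∧ u_{m i - k n} ∧ u_{m (i+1)} ∧ ⋯`. -/
noncomputable def moveFactor (F : MetaplecticData n K) (k : ℤ) : ℕ → NormalWedge → FockSpace K
  | 0, w => F.wedge (w.m 0 - k * n) (Finsupp.single w.tail 1)
  | i + 1, w => F.wedge (w.m 0) (moveFactor F k i w.tail)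

/-- The current operator `J_k` (`k ≠ 0`): it moves one factor by `k n`, summed over all factors.
On each basis vector all but finitely many summands vanish. -/
noncomputable def current (F : MetaplecticData n K) (k : ℤ) : FockSpace K →ₗ[K] FockSpace K :=
  Finsupp.linearCombination K fun w => ∑ᶠ i : ℕ, F.moveFactor k i w

/-- The Hamiltonian `H = ∑_{k ≥ 1} s_k J_k`; a locally finite sum. -/
noncomputable def hamiltonian (F : MetaplecticData n K) (s : ℕ → K) :
    FockSpace K →ₗ[K] FockSpace K :=
  Finsupp.linearCombination K fun w =>
    ∑ᶠ k : ℕ, s (k + 1) • F.current ((k : ℤ) + 1) (Finsupp.single w 1)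

/-- `e^H |w⟩ = ∑_r H^r |w⟩ / r!`; the operator `H` is locally nilpotent. -/
noncomputable def expHamiltonian (F : MetaplecticData n K) (s : ℕ → K) (w : NormalWedge) :
    FockSpace K :=
  ∑ᶠ r : ℕ, (r.factorial : K)⁻¹ • (F.hamiltonian s ^ r) (Finsupp.single w 1)

end MetaplecticData

/-! ## Partitions and supersymmetric LLT polynomials -/

/-- `λ + ρ`, where `ρ = (ℓ - 1, …, 1, 0)`. -/
def addRho {ℓ : ℕ} (lam : Fin ℓ → ℕ) (i : Fin ℓ) : ℕ := lam i + (ℓ - 1 - i)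

theorem addRho_strictAnti {ℓ : ℕ} {lam : Fin ℓ → ℕ} (h : Antitone lam) :
    StrictAnti (addRho lam) := by
  intro i j hij
  have h1 := h hij.le
  have h2 : (i : ℕ) < j := hij
  have h3 := j.isLt
  unfold addRho
  omega

/-- The supersymmetric LLT polynomial
`𝒢_{λ/μ}(θ|π; q) = ⟨μ+ρ| e^{L₊(θ) - L₊(π)} |λ+ρ⟩`, where `L₊(θ) = ∑_{k≥1} ∑_j (θ_j^k / k) J_k`,
in the Fock space with data `F` (the parameter `q` is `F.q`). -/
noncomputable def superLLT {n : ℕ} {K : Type*} [Field K] (F : MetaplecticData n K) {N ℓ : ℕ}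
    (lam mu : Fin ℓ → ℕ) (hlam : Antitone lam) (hmu : Antitone mu) (θ π : Fin N → K) : K :=
  F.expHamiltonian (fun k => ∑ j, θ j ^ k / k - ∑ j, π j ^ k / k)
    (NormalWedge.ofStrict (addRho lam) (addRho_strictAnti hlam))
    (NormalWedge.ofStrict (addRho mu) (addRho_strictAnti hmu))

/-! ## Six-vertex models with charge -/

/-- The Boltzmann weights of one row. -/
structure BoltzmannWeights (n : ℕ) (K : Type*) where
  a₁ : K
  a₂ : ZMod n → K
  b₁ : K
  b₂ : ZMod n → K
  c₁ : K
  c₂ : K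

/-- A decorated horizontal spin: `none` is the spin `+`, and `some a` is the spin `-` with
charge `a`. -/
abbrev DecoratedSpin (n : ℕ) := Option (ZMod n)

namespace BoltzmannWeights

variable {n : ℕ} {K : Type*} [Field K]

/-- The weight of a vertex of the model `𝔖^q` with the given left, top, right and bottom spins
(for vertical spins, `true` is `-` and `false` is `+`).  Inadmissible vertices have weight `0`. -/
def deltaVertex (W : BoltzmannWeights n K) : DecoratedSpin n → Bool → DecoratedSpin n → Bool → K
  | none, false, none, false => W.a₁
  | some b, true, some a, true => if b = a + 1 then W.a₂ a else 0
  | none, true, none, true => W.b₁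
  | some b, false, some a, false => if b = a + 1 then W.b₂ a else 0
  | some b, false, none, true => if b = 1 then W.c₁ else 0
  | none, true, some a, false => if a = 0 then W.c₂ else 0
  | _, _, _, _ => 0

/-- The weight of a vertex of the model `𝔖^{*,q}` with the given left, top, right and bottom
spins. -/
def gammaVertex (W : BoltzmannWeights n K) : DecoratedSpin n → Bool → DecoratedSpin n → Bool → K
  | none, false, none, false => W.a₁
  | some a, true, some b, true => if b = a + 1 then W.a₂ a else 0
  | none, true, none, true => W.b₁
  | some a, false, some b, false => if b = a + 1 then W.b₂ a else 0
  | none, false, some b, true => if b = 1 then W.c₁ else 0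
  | some a, true, none, false => if a = 0 then W.c₂ else 0
  | _, _, _, _ => 0

end BoltzmannWeights

section FreeFermion

variable {n N : ℕ} {K : Type*} [Field K]

/-- The generalized free fermion condition: in every row, the zero-charge free fermion condition
and the charge condition. -/
def GeneralizedFreeFermionic (W : Fin N → BoltzmannWeights n K) : Prop :=
  ∀ i, (W i).a₁ * (W i).a₂ 0 + (W i).b₁ * (W i).b₂ 0 - (W i).c₁ * (W i).c₂ = 0 ∧
    ∀ a : ZMod n, a ≠ 0 →
      ((W i).a₁ * (W i).a₂ a * (W i).a₂ (-a)) / ((W i).b₁ * (W i).b₂ a * (W i).b₂ (-a)) =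
        -((W i).a₂ 0 / (W i).b₂ 0)

/-- The metaplectic Fock space given by `F` is that of the generalized free fermionic weights `W`:
`a₁ a₂(a) / (b₁ b₂(a)) = g(a)` in every row, for all nonzero charges `a`.  For `n ≥ 2` the same
equation for `a = 0` follows from the charge condition; for `n = 1` there is no condition, the Fock
space being the classical one for all `q`. -/
def MetaplecticData.IsFockSpaceOf (F : MetaplecticData n K) (W : Fin N → BoltzmannWeights n K) :
    Prop :=
  ∀ i, ∀ a : ZMod n, a ≠ 0 → ((W i).a₁ * (W i).a₂ a) / ((W i).b₁ * (W i).b₂ a) = F.g a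

end FreeFermion

/-- The parameters of the charged models with `N` rows. -/
structure ChargedParams (n N : ℕ) (K : Type*) where
  x : Fin N → K
  y : Fin N → K
  A : Fin N → K
  B : Fin N → K
  f : ZMod n → K
  h : ZMod n → K

namespace ChargedParams

variable {n N : ℕ} {K : Type*} [Field K]

/-- All parameters are nonzero. -/
def Nondegenerate (P : ChargedParams n N K) : Prop :=
  (∀ i, P.x i ≠ 0 ∧ P.y i ≠ 0 ∧ P.A i ≠ 0 ∧ P.B i ≠ 0) ∧ ∀ a, P.f a ≠ 0 ∧ P.h a ≠ 0

/-- The Boltzmann weights of `𝔖^q` in row `i`. -/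
def deltaWeights (P : ChargedParams n N K) (i : Fin N) : BoltzmannWeights n K where
  a₁ := P.A i
  a₂ := fun a => P.h a * P.y i * P.A i * P.B i
  b₁ := P.A i * P.B i
  b₂ := fun a => P.f a * P.x i * P.A i
  c₁ := (P.f 0 * P.x i + P.h 0 * P.y i) * P.A i * P.B i
  c₂ := P.A i

/-- The Boltzmann weights of `𝔖^{*,q}` in row `i`. -/
def gammaWeights (P : ChargedParams n N K) (i : Fin N) : BoltzmannWeights n K where
  a₁ := (P.A i)⁻¹
  a₂ := fun a => P.f a * P.x i * (P.A i)⁻¹ * (P.B i)⁻¹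
  b₁ := (P.A i)⁻¹ * (P.B i)⁻¹
  b₂ := fun a => P.h a * P.y i * (P.A i)⁻¹
  c₁ := (P.f 0 * P.x i + P.h 0 * P.y i) * (P.A i)⁻¹
  c₂ := (P.A i)⁻¹ * (P.B i)⁻¹

end ChargedParams

/-- A spin configuration on a grid with `N` rows and columns `0, …, M` (from left to right).
`vert r c` is the spin of the vertical edge in column `c` at level `r`; row `i` lies between the
levels `i` and `i + 1`.  The edge `horiz i c` is to the left of column `c` in row `i`, and
`horiz i (c + 1)` is to its right. -/
abbrev Configuration (n N M : ℕ) :=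
  (Fin (N + 1) → Fin (M + 1) → Bool) × (Fin N → Fin (M + 2) → DecoratedSpin n)

namespace Configuration

variable {n N M : ℕ}

/-- The vertical edge in column `c` at level `r`. -/
def vert (s : Configuration n N M) (r : Fin (N + 1)) (c : Fin (M + 1)) : Bool := s.1 r c

/-- The horizontal edge number `c` of row `i`. -/
def horiz (s : Configuration n N M) (i : Fin N) (c : Fin (M + 2)) : DecoratedSpin n := s.2 i c

end Configuration

/-- The boundary spins given by a strict partition: `-` on its parts, `+` elsewhere. -/
def boundarySpins (M : ℕ) {ℓ : ℕ} (κ : Fin ℓ → ℕ) (c : Fin (M + 1)) : Bool :=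
  decide (∃ i, κ i = c)

/-- The configurations with boundary spins `κ` at level `0`, `ν` at level `N`, and `+` on the left
and right boundary edges. -/
def boundaryConfigurations (n N M : ℕ) [NeZero n] {ℓ : ℕ} (κ ν : Fin ℓ → ℕ) :
    Finset (Configuration n N M) :=
  Finset.univ.filter fun s =>
    s.vert 0 = boundarySpins M κ ∧ s.vert (Fin.last N) = boundarySpins M ν ∧
      ∀ i, s.horiz i 0 = none ∧ s.horiz i (Fin.last (M + 1)) = none

namespace ChargedParams

variable {n N : ℕ} [NeZero n] {K : Type*} [Field K]

/-- The partition function `Z(𝔖^q_{κ/ν})` with `M + 1` columns.  Rows and levels are counted from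
bottom to top, so that `κ` is the bottom boundary and `ν` the top boundary. -/
def deltaZ (P : ChargedParams n N K) (M : ℕ) {ℓ : ℕ} (κ ν : Fin ℓ → ℕ) : K :=
  ∑ s ∈ boundaryConfigurations n N M κ ν, ∏ i : Fin N, ∏ c : Fin (M + 1),
    (P.deltaWeights i).deltaVertex
      (s.horiz i c.castSucc) (s.vert i.succ c) (s.horiz i c.succ) (s.vert i.castSucc c)

/-- The partition function `Z(𝔖^{*,q}_{κ/ν})` with `M + 1` columns.  Rows and levels are counted
from top to bottom, so that `κ` is the top boundary and `ν` the bottom boundary. -/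
def gammaZ (P : ChargedParams n N K) (M : ℕ) {ℓ : ℕ} (κ ν : Fin ℓ → ℕ) : K :=
  ∑ s ∈ boundaryConfigurations n N M κ ν, ∏ i : Fin N, ∏ c : Fin (M + 1),
    (P.gammaWeights i).gammaVertex
      (s.horiz i c.castSucc) (s.vert i.castSucc c) (s.horiz i c.succ) (s.vert i.succ c)

/-- `θ_i = x_i^n F`, where `F = ∏_a f(a)`. -/
def theta (P : ChargedParams n N K) (i : Fin N) : K := P.x i ^ n * ∏ a, P.f a

/-- `π_i = -(h(0)/f(0)) x_i^{n-1} y_i F`. -/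
def pi (P : ChargedParams n N K) (i : Fin N) : K :=
  -(P.h 0 / P.f 0) * P.x i ^ (n - 1) * P.y i * ∏ a, P.f a

/-- `η_i = y_i^n H`, where `H = ∏_a h(a)`. -/
def eta (P : ChargedParams n N K) (i : Fin N) : K := P.y i ^ n * ∏ a, P.h a

/-- `τ_i = -(f(0)/h(0)) y_i^{n-1} x_i H`. -/
def tau (P : ChargedParams n N K) (i : Fin N) : K :=
  -(P.f 0 / P.h 0) * P.y i ^ (n - 1) * P.x i * ∏ a, P.h a

end ChargedParams

namespace ChargedParams

variable {n N : ℕ} {K : Type*} [Field K]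

/-- The weights of `𝔖^{*,q}` are generalized free fermionic iff those of `𝔖^q` are. -/
theorem gammaWeights_generalizedFreeFermionic_iff (P : ChargedParams n N K)
    (hP : P.Nondegenerate) :
    GeneralizedFreeFermionic P.gammaWeights ↔ GeneralizedFreeFermionic P.deltaWeights := by
  obtain ⟨h1, h2⟩ := hP
  refine forall_congr' fun i => and_congr ?_ (forall_congr' fun a => imp_congr_right fun _ => ?_)
  · refine iff_of_true ?_ ?_ <;> simp only [gammaWeights, deltaWeights] <;> ring
  · obtain ⟨hx, hy, hA, hB⟩ := h1 i
    have ha := h2 a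
    have hb := h2 (-a)
    have hc := h2 0
    obtain ⟨ha1, ha2⟩ := ha
    obtain ⟨hb1, hb2⟩ := hb
    obtain ⟨hc1, hc2⟩ := hc
    simp only [gammaWeights, deltaWeights]
    field_simp
    constructor <;> intro h <;> linear_combination h

/-- Over an algebraically closed field, generalized free fermionic weights have a metaplectic Fock
space. -/
theorem exists_isFockSpaceOf [IsAlgClosed K] (P : ChargedParams n N K)
    (hP : P.Nondegenerate) (hFF : GeneralizedFreeFermionic P.deltaWeights) :
    ∃ F : MetaplecticData n K, F.IsFockSpaceOf P.deltaWeights := by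
  classical
  obtain ⟨h1, h2⟩ := hP
  by_cases hN : Nonempty (Fin N)
  swap
  · exact ⟨⟨1, one_ne_zero, 1, rfl, fun _ => by simp⟩, fun i => (hN ⟨i⟩).elim⟩
  obtain ⟨i₀⟩ := hN
  obtain ⟨q, hq⟩ := IsAlgClosed.exists_pow_nat_eq
    (-(P.h 0 * P.y i₀ / (P.f 0 * P.x i₀))) (n := 2) (by norm_num)
  have hcond : ∀ i, ∀ a : ZMod n, a ≠ 0 →
      P.h a * P.h (-a) * P.y i * P.f 0 = -(P.h 0 * P.f a * P.f (-a) * P.x i) := by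
    intro i a ha
    obtain ⟨hx, hy, hA, hB⟩ := h1 i
    obtain ⟨ha1, ha2⟩ := h2 a
    obtain ⟨hb1, hb2⟩ := h2 (-a)
    obtain ⟨hc1, hc2⟩ := h2 0
    have := (hFF i).2 a ha
    simp only [deltaWeights] at this
    field_simp at this
    linear_combination this
  obtain ⟨hx, hy, hA, hB⟩ := h1 i₀
  obtain ⟨hc1, hc2⟩ := h2 0
  have hq0 : q ≠ 0 := by
    rintro rfl
    have : P.h 0 * P.y i₀ / (P.f 0 * P.x i₀) ≠ 0 := by positivity
    apply this
    linear_combination hq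
  refine ⟨⟨q, hq0, fun a => if a = 0 then 1 else -(P.h a * P.y i₀ / (P.f a * P.x i₀)) / q,
    by simp, fun a => ?_⟩, fun i a ha => ?_⟩
  · by_cases ha : a = 0
    · simp [ha]
    · obtain ⟨ha1, ha2⟩ := h2 a
      obtain ⟨hb1, hb2⟩ := h2 (-a)
      have := hcond i₀ a ha
      simp only [ha, neg_eq_zero, if_false]
      field_simp
      rw [hq]
      field_simp
      linear_combination this
  · obtain ⟨hx', hy', hA', hB'⟩ := h1 i
    obtain ⟨ha1, ha2⟩ := h2 a
    obtain ⟨hb1, hb2⟩ := h2 (-a)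
    have e1 := hcond i a ha
    have e2 := hcond i₀ a ha
    have key : P.y i * P.x i₀ = P.y i₀ * P.x i := by
      have hne : P.h a * P.h (-a) * P.f 0 ≠ 0 := by positivity
      apply mul_left_cancel₀ hne
      linear_combination P.x i₀ * e1 - P.x i * e2
    simp only [deltaWeights, MetaplecticData.g, ha, if_false]
    field_simp
    linear_combination key

end ChargedParams

/-!
Write `u_m` for the operator of wedging with `u_m` on the left.  Everything follows from two facts
about these operators: the straightening relation for `u_l u_m` holds on the whole Fock space, and
not only in front of vectors which do not involve indices above `m`, and `[J_k, u_m] = u_{m - kn}`.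
Both are proved together, by induction on how far the vector may reach above `m`.  The induction
step combines the two relations that are obtained by commuting `J_1` and `(J_1 ^ 2 - J_2) / 2` with
the straightening relation of two indices with difference less than `n`.

Consequently conjugation by `E = e^{L_+(θ) - L_+(π)}`, for a single pair of parameters, acts on
`u_m, u_{m-n}, u_{m-2n}, …` as `(1 - π X) / (1 - θ X)`, where `X` shifts the index by `n`.  So `E`
is determined by fixing the vacuum and by `E u_m - θ E u_{m-n} = u_m E - π u_{m-n} E`.

A row of `𝔖^q`, with weights normalized by a gauge transformation, acts on wedges of boundary
spins by an operator which is built up one column at a time.  Moving a charged line through the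
columns with the straightening relation, one sees that this operator satisfies the same relation:
the charge runs once through `ℤ/n`, which produces `θ = ∏ f(a) x`.  Multiplying the rows gives the
formula for `𝔖^q`.  Finally `𝔖^{*,q}` becomes `𝔖^q` with the roles of `f, x` and `h, y` exchanged
after reflecting the charges, and this exchange turns `q` into `q⁻¹`.
-/

/-! ## Normal ordering -/

namespace MetaplecticData

variable {n : ℕ} {K : Type*} [Field K] (F : MetaplecticData n K)
  {E E' : Type*} [AddCommGroup E] [Module K E] [AddCommGroup E'] [Module K E']

theorem normalOrder_of_emod_eq_zero {l m : ℤ} (h : (m - l) % n = 0) (U : ℤ → ℤ → E) :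
    F.normalOrder l m U = -U m l := by
  simp [normalOrder, h]

theorem normalOrder_of_emod_ne_zero {l m : ℤ} (h : (m - l) % n ≠ 0) (U : ℤ → ℤ → E) :
    F.normalOrder l m U = F.g ((l - m : ℤ) : ZMod n) • U m l +
      (F.q ^ 2 - 1) • ∑ t ∈ Finset.range (m - l).toNat, (F.q ^ 2) ^ t •
      ((if l + (m - l) % n + t * n < m - (m - l) % n - t * n then
          U (m - (m - l) % n - t * n) (l + (m - l) % n + t * n) else 0) +
        (if l + (t + 1) * n < m - (t + 1) * n then
          F.g ((l - m : ℤ) : ZMod n) • U (m - (t + 1) * n) (l + (t + 1) * n) else 0)) := by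
  simp [normalOrder, h]

theorem map_normalOrder (φ : E →ₗ[K] E') (l m : ℤ) (U : ℤ → ℤ → E) :
    φ (F.normalOrder l m U) = F.normalOrder l m fun a b => φ (U a b) := by
  by_cases h : (m - l) % n = 0
  · simp [normalOrder_of_emod_eq_zero F h]
  · simp [normalOrder_of_emod_ne_zero F h, apply_ite φ]

theorem normalOrder_add (l m : ℤ) (U V : ℤ → ℤ → E) :
    F.normalOrder l m (fun a b => U a b + V a b) =
      F.normalOrder l m U + F.normalOrder l m V := by
  have map_pair (φ : E × E →ₗ[K] E) :=
    F.map_normalOrder φ l m fun a b => (U a b, V a b)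
  calc
    _ = (LinearMap.fst K E E + LinearMap.snd K E E)
          (F.normalOrder l m fun a b => (U a b, V a b)) := (map_pair _).symm
    _ = _ := congrArg₂ (· + ·) (map_pair (.fst K E E)) (map_pair (.snd K E E))

theorem normalOrder_sub (l m : ℤ) (U V : ℤ → ℤ → E) :
    F.normalOrder l m (fun a b => U a b - V a b) =
      F.normalOrder l m U - F.normalOrder l m V := by
  rw [eq_sub_iff_add_eq, ← normalOrder_add]
  simp only [sub_add_cancel]

theorem normalOrder_sub_sub (k l m : ℤ) (U : ℤ → ℤ → E) :
    F.normalOrder (l - k) (m - k) U = F.normalOrder l m fun a b => U (a - k) (b - k) := by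
  have hml : m - k - (l - k) = m - l := by ring
  have hlm : l - k - (m - k) = l - m := by ring
  by_cases h : (m - l) % n = 0
  · rw [normalOrder_of_emod_eq_zero F h, normalOrder_of_emod_eq_zero F (by rwa [hml])]
  · rw [normalOrder_of_emod_ne_zero F h, normalOrder_of_emod_ne_zero F (by rwa [hml]), hml, hlm]
    congr 2
    refine Finset.sum_congr rfl fun t _ =>
      congrArg _ (congrArg₂ _ (if_congr ?_ ?_ rfl) (if_congr ?_ ?_ rfl))
    · constructor <;> intro h <;> linarith
    · congr 1 <;> ring
    · constructor <;> intro h <;> linarith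
    · congr 2 <;> ring

theorem normalOrder_congr {l m : ℤ} (hlm : l < m) {U V : ℤ → ℤ → E}
    (h : ∀ a b, l ≤ b → b < a → a ≤ m → a + b = l + m → U a b = V a b) :
    F.normalOrder l m U = F.normalOrder l m V := by
  by_cases h0 : (m - l) % n = 0
  · rw [normalOrder_of_emod_eq_zero F h0, normalOrder_of_emod_eq_zero F h0,
      h m l le_rfl hlm le_rfl (by ring)]
  · rw [normalOrder_of_emod_ne_zero F h0, normalOrder_of_emod_ne_zero F h0,
      h m l le_rfl hlm le_rfl (by ring)]
    congr 2
    refine Finset.sum_congr rfl fun t _ => congrArg _ (congrArg₂ _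
      (ite_congr rfl (fun ht' => ?_) fun _ => rfl) (ite_congr rfl (fun ht' => ?_) fun _ => rfl))
    all_goals have ht : (0 : ℤ) ≤ t * n := by positivity
    · have hi : 0 ≤ (m - l) % (n : ℤ) := by
        rcases eq_or_ne (n : ℤ) 0 with hn | hn
        · simpa [hn] using hlm.le
        · exact Int.emod_nonneg _ hn
      exact h _ _ (by linarith) ht' (by linarith) (by ring)
    · rw [h _ _ (by nlinarith) ht' (by nlinarith) (by ring)]

theorem normalOrder_mem {l m : ℤ} (hlm : l < m) {U : ℤ → ℤ → E} (S : Submodule K E)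
    (h : ∀ a b, l ≤ b → b < a → a ≤ m → a + b = l + m → U a b ∈ S) :
    F.normalOrder l m U ∈ S := by
  rw [← Submodule.Quotient.mk_eq_zero, ← Submodule.mkQ_apply, map_normalOrder]
  calc
    _ = F.normalOrder l m fun _ _ => (0 : E →ₗ[K] E ⧸ S) 0 :=
        F.normalOrder_congr hlm fun a b hlb hba ham hab => by simpa using h a b hlb hba ham hab
    _ = 0 := by rw [← map_normalOrder F (0 : E →ₗ[K] E ⧸ S) l m fun _ _ => (0 : E)]; rfl

end MetaplecticData

/-! ## The filtration by the first index -/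

namespace NormalWedge

theorem tail_lt (w : NormalWedge) : w.tail.m 0 < w.m 0 :=
  w.strictAnti Nat.zero_lt_one

theorem cons_tail (w : NormalWedge) : w.tail.cons (w.m 0) w.tail_lt = w := by
  ext i
  cases i <;> rfl

end NormalWedge

namespace MetaplecticData

variable {n : ℕ} {K : Type*} [Field K] (F : MetaplecticData n K)

section Filtration

variable (K) in
/-- The span of the normally ordered wedges whose first index is less than `c`.  These subspaces
form an exhaustive increasing filtration of the Fock space. -/
noncomputable def firstLT (c : ℤ) : Submodule K (FockSpace K) :=
  Finsupp.supported K K {w : NormalWedge | w.m 0 < c}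

theorem single_mem_firstLT {w : NormalWedge} {c : ℤ} (h : w.m 0 < c) (x : K) :
    Finsupp.single w x ∈ firstLT K c :=
  Finsupp.single_mem_supported K x h

theorem firstLT_mono {c d : ℤ} (h : c ≤ d) : firstLT K c ≤ firstLT K d :=
  Finsupp.supported_mono fun _ hw => lt_of_lt_of_le hw h

theorem firstLT_le {c : ℤ} {S : Submodule K (FockSpace K)}
    (h : ∀ w : NormalWedge, w.m 0 < c → Finsupp.single w (1 : K) ∈ S) : firstLT K c ≤ S := by
  rw [firstLT, Finsupp.supported_eq_span_single, Submodule.span_le]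
  rintro _ ⟨w, hw, rfl⟩
  exact h w hw

theorem eqOn_firstLT {E : Type*} [AddCommGroup E] [Module K E] {f g : FockSpace K →ₗ[K] E} {c : ℤ}
    (h : ∀ w : NormalWedge, w.m 0 < c → f (Finsupp.single w 1) = g (Finsupp.single w 1)) :
    ∀ v ∈ firstLT K c, f v = g v :=
  firstLT_le (S := LinearMap.eqLocus f g) h

theorem exists_mem_firstLT (v : FockSpace K) : ∃ c, v ∈ firstLT K c := by
  induction v using Finsupp.induction_linear with
  | zero => exact ⟨0, Submodule.zero_mem _⟩
  | add f g hf hg =>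
    obtain ⟨c, hc⟩ := hf
    obtain ⟨d, hd⟩ := hg
    exact ⟨max c d, Submodule.add_mem _ (firstLT_mono (le_max_left _ _) hc)
      (firstLT_mono (le_max_right _ _) hd)⟩
  | single w x => exact ⟨w.m 0 + 1, single_mem_firstLT (lt_add_one _) x⟩

end Filtration

theorem insertAux_mem_firstLT (d : ℕ) {j : ℤ} {w : NormalWedge} {c : ℤ} (hw : w.m 0 < c)
    (hj : j < c) : F.insertAux d j w ∈ firstLT K c := by
  induction d generalizing j w with
  | zero =>
    unfold insertAux
    split_ifs
    · exact single_mem_firstLT hj _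
    · exact Submodule.zero_mem _
  | succ d ih =>
    unfold insertAux
    split_ifs
    · exact single_mem_firstLT hj _
    · exact Submodule.zero_mem _
    · refine F.normalOrder_mem (by omega) _ fun a b _ _ _ _ => ?_
      have insert_mem : firstLT K c ≤ (firstLT K c).comap
          (Finsupp.linearCombination K (F.insertAux d a)) :=
        firstLT_le fun w' hw' => by simpa using ih hw' (by omega)
      exact insert_mem (ih (w.tail_lt.trans hw) (by omega))

theorem insertAux_succ {d : ℕ} {j : ℤ} {w : NormalWedge} (h : w.m 0 - j ≤ d) :
    F.insertAux (d + 1) j w = F.insertAux d j w := by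
  induction d generalizing j w with
  | zero =>
    by_cases hj : w.m 0 < j
    · simp [insertAux, hj]
    · have : j = w.m 0 := by push_cast at h; omega
      simp [insertAux, this]
  | succ d ih =>
    rw [insertAux, insertAux]
    split_ifs
    · rfl
    · rfl
    · push_cast at h
      have ht := w.tail_lt
      refine F.normalOrder_congr (by omega) fun a b _ _ _ _ => ?_
      rw [ih (by omega)]
      refine eqOn_firstLT (c := w.m 0) (fun w' hw' => ?_) _
        (F.insertAux_mem_firstLT d ht (by omega))
      simpa using ih (by omega)

theorem insertAux_eq_wedge {d : ℕ} {j : ℤ} {w : NormalWedge} (h : w.m 0 - j ≤ d) :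
    F.insertAux d j w = F.wedge j (Finsupp.single w 1) := by
  rw [wedge, Finsupp.linearCombination_single, one_smul]
  have hd : (w.m 0 - j).toNat ≤ d := by omega
  induction d, hd using Nat.le_induction with
  | base => rfl
  | succ d hd ih => rw [F.insertAux_succ (by omega), ih (by omega)]

theorem wedge_single_of_lt {j : ℤ} {w : NormalWedge} (h : w.m 0 < j) :
    F.wedge j (Finsupp.single w 1) = Finsupp.single (w.cons j h) 1 := by
  rw [← insertAux_eq_wedge F (d := 0) (by push_cast; omega), insertAux, dif_pos h]

theorem wedge_single_tail (w : NormalWedge) :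
    F.wedge (w.m 0) (Finsupp.single w.tail 1) = Finsupp.single w 1 := by
  rw [F.wedge_single_of_lt w.tail_lt, NormalWedge.cons_tail]

theorem wedge_single_self (w : NormalWedge) : F.wedge (w.m 0) (Finsupp.single w 1) = 0 := by
  rw [← insertAux_eq_wedge F (d := 0) (by push_cast; omega), insertAux, dif_neg (lt_irrefl _)]

theorem wedge_mem_firstLT {j c : ℤ} (hj : j < c) {v : FockSpace K} (hv : v ∈ firstLT K c) :
    F.wedge j v ∈ firstLT K c := by
  have hle : firstLT K c ≤ (firstLT K c).comap (F.wedge j) :=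
    firstLT_le fun w hw => by simpa [wedge] using F.insertAux_mem_firstLT _ hw hj
  exact hle hv

theorem wedge_single_of_gt {j : ℤ} {w : NormalWedge} (h : j < w.m 0) :
    F.wedge j (Finsupp.single w 1) =
      F.normalOrder j (w.m 0) fun a b => F.wedge a (F.wedge b (Finsupp.single w.tail 1)) := by
  obtain ⟨d, hd⟩ : ∃ d : ℕ, w.m 0 - j = d + 1 := ⟨(w.m 0 - j - 1).toNat, by omega⟩
  rw [← insertAux_eq_wedge F (d := d + 1) (by push_cast; omega), insertAux,
    dif_neg (by omega), if_neg (by omega)]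
  have ht := w.tail_lt
  refine F.normalOrder_congr h fun a b _ _ _ _ => ?_
  rw [insertAux_eq_wedge F (by omega)]
  refine eqOn_firstLT (c := w.m 0) (fun w' hw' => ?_) _
    (F.wedge_mem_firstLT (by omega) (single_mem_firstLT ht _))
  rw [Finsupp.linearCombination_single, one_smul, insertAux_eq_wedge F (by omega)]

theorem wedge_wedge_self_of_mem {m : ℤ} {v : FockSpace K} (hv : v ∈ firstLT K m) :
    F.wedge m (F.wedge m v) = 0 := by
  refine eqOn_firstLT (f := F.wedge m ∘ₗ F.wedge m) (g := 0) (fun w hw => ?_) v hv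
  rw [LinearMap.comp_apply, F.wedge_single_of_lt hw]
  exact F.wedge_single_self (w.cons m hw)

theorem wedge_wedge_of_mem {l m : ℤ} (hlm : l < m) {v : FockSpace K} (hv : v ∈ firstLT K m) :
    F.wedge l (F.wedge m v) = F.normalOrder l m fun a b => F.wedge a (F.wedge b v) := by
  have apply_normalOrder v : (F.normalOrder l m fun a b => F.wedge a ∘ₗ F.wedge b) v =
      F.normalOrder l m fun a b => F.wedge a (F.wedge b v) :=
    F.map_normalOrder (LinearMap.applyₗ v) l m fun a b => F.wedge a ∘ₗ F.wedge b
  rw [← apply_normalOrder]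
  refine eqOn_firstLT (f := F.wedge l ∘ₗ F.wedge m) (fun w hw => ?_) v hv
  rw [apply_normalOrder, LinearMap.comp_apply, F.wedge_single_of_lt hw]
  exact F.wedge_single_of_gt (w := w.cons m hw) hlm

theorem eqOn_firstLT_of_wedge {E : Type*} [AddCommGroup E] [Module K E]
    {f g : FockSpace K →ₗ[K] E} {c d : ℤ} (base : ∀ v ∈ firstLT K d, f v = g v)
    (step : ∀ p, d ≤ p → p < c → (∀ v ∈ firstLT K p, f v = g v) →
      ∀ v ∈ firstLT K p, f (F.wedge p v) = g (F.wedge p v)) :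
    ∀ v ∈ firstLT K c, f v = g v := by
  rcases le_total c d with hcd | hdc
  · exact fun v hv => base v (firstLT_mono hcd hv)
  induction c, hdc using Int.leInduction with
  | base => exact base
  | succ c hdc ih =>
    have ih := ih fun p hdp hpc => step p hdp (by omega)
    refine eqOn_firstLT fun w hw => ?_
    rcases (Int.lt_add_one_iff.1 hw).lt_or_eq with hw | rfl
    · exact ih _ (single_mem_firstLT hw 1)
    · rw [← F.wedge_single_tail w]
      exact step _ hdc (by omega) ih _ (single_mem_firstLT w.tail_lt 1)

end MetaplecticData

/-! ## Vacua -/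

namespace NormalWedge

/-- A vacuum is a normally ordered wedge `u_m ∧ u_{m-1} ∧ u_{m-2} ∧ ⋯`. -/
def IsVacuum (w : NormalWedge) : Prop := ∀ i, w.m (i + 1) = w.m i - 1

theorem IsVacuum.tail {w : NormalWedge} (h : w.IsVacuum) : w.tail.IsVacuum :=
  fun i => h (i + 1)

theorem induction_tail {P : NormalWedge → Prop} (vacuum : ∀ w, w.IsVacuum → P w)
    (cons : ∀ w, P w.tail → P w) (w : NormalWedge) : P w := by
  obtain ⟨R, hR⟩ := w.eventually
  induction R generalizing w with
  | zero => exact vacuum w fun i => hR i (Nat.zero_le i)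
  | succ R ih => exact cons w (ih w.tail fun i hi => hR (i + 1) (by omega))

end NormalWedge

namespace MetaplecticData

variable {n : ℕ} {K : Type*} [Field K] (F : MetaplecticData n K)

theorem wedge_vacuum {w : NormalWedge} (hw : w.IsVacuum) {j : ℤ} (hj : j ≤ w.m 0) :
    F.wedge j (Finsupp.single w 1) = 0 := by
  obtain ⟨d, hd⟩ : ∃ d : ℕ, w.m 0 - j = d := ⟨(w.m 0 - j).toNat, by omega⟩
  induction d using Nat.strong_induction_on generalizing w j with
  | _ d ih =>
    rcases hj.eq_or_lt with h | h
    · rw [h, wedge_single_self]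
    · rw [F.wedge_single_of_gt h]
      have ht : w.tail.m 0 = w.m 0 - 1 := hw 0
      refine (Submodule.mem_bot K).1 (F.normalOrder_mem h _ fun a b _ _ _ _ => ?_)
      rw [ih (w.tail.m 0 - b).toNat (by omega) hw.tail (by omega) (by omega), map_zero]
      exact Submodule.zero_mem _

theorem mem_of_wedge {S : Submodule K (FockSpace K)}
    (vacuum : ∀ w : NormalWedge, w.IsVacuum → Finsupp.single w 1 ∈ S)
    (wedge : ∀ p, ∀ v ∈ firstLT K p, v ∈ S → F.wedge p v ∈ S) (v : FockSpace K) : v ∈ S := by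
  have single_mem (w : NormalWedge) : Finsupp.single w (1 : K) ∈ S := by
    induction w using NormalWedge.induction_tail with
    | vacuum w hw => exact vacuum w hw
    | cons w ih =>
      rw [← F.wedge_single_tail w]
      exact wedge _ _ (single_mem_firstLT w.tail_lt 1) ih
  induction v using Finsupp.induction_linear with
  | zero => exact S.zero_mem
  | add v v' hv hv' => exact S.add_mem hv hv'
  | single w x => simpa using S.smul_mem x (single_mem w)

theorem linearMap_ext_of_wedge {E : Type*} [AddCommGroup E] [Module K E]
    {f g : FockSpace K →ₗ[K] E}
    (vacuum : ∀ w : NormalWedge, w.IsVacuum → f (Finsupp.single w 1) = g (Finsupp.single w 1))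
    (wedge : ∀ p, ∀ v ∈ firstLT K p, f v = g v → f (F.wedge p v) = g (F.wedge p v)) :
    f = g :=
  LinearMap.ext fun v => F.mem_of_wedge (S := f.eqLocus g) vacuum wedge v

end MetaplecticData

/-! ## The currents below the first index -/

theorem finsum_eq_zero_add {E : Type*} [AddCommMonoid E] {f : ℕ → E} (hf : f.HasFiniteSupport) :
    ∑ᶠ i, f i = f 0 + ∑ᶠ i, f (i + 1) := by
  obtain ⟨N, hN⟩ := hf.bddAbove
  have support_f : Function.support f ⊆ (Finset.range (N + 1) : Set ℕ) := fun i hi => by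
    simpa [Nat.lt_succ_iff] using hN hi
  have support_succ : (Function.support fun i => f (i + 1)) ⊆ (Finset.range N : Set ℕ) :=
    fun i hi => by simpa using Nat.lt_of_succ_le (hN hi)
  rw [finsum_eq_sum_of_support_subset _ support_f, finsum_eq_sum_of_support_subset _ support_succ,
    Finset.sum_range_succ', add_comm]

namespace MetaplecticData

variable {n : ℕ} {K : Type*} [Field K] (F : MetaplecticData n K) [NeZero n]

theorem moveFactor_vacuum {k : ℤ} (hk : 0 < k) (i : ℕ) {w : NormalWedge} (hw : w.IsVacuum) :
    F.moveFactor k i w = 0 := by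
  induction i generalizing w with
  | zero =>
    have hkn : 0 < k * n := mul_pos hk (Int.natCast_pos.2 (NeZero.pos n))
    have ht : w.tail.m 0 = w.m 0 - 1 := hw 0
    rw [moveFactor, F.wedge_vacuum hw.tail (by omega)]
  | succ i ih => rw [moveFactor, ih hw.tail, map_zero]

theorem hasFiniteSupport_moveFactor {k : ℤ} (hk : 0 < k) (w : NormalWedge) :
    (fun i => F.moveFactor k i w).HasFiniteSupport := by
  induction w using NormalWedge.induction_tail with
  | vacuum w hw => simp [Function.HasFiniteSupport, F.moveFactor_vacuum hk _ hw]
  | cons w ih =>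
    refine ((Set.finite_singleton 0).union (Set.Finite.image Nat.succ ih)).subset fun i hi => ?_
    cases i with
    | zero => exact Or.inl rfl
    | succ i =>
      refine Or.inr ⟨i, fun h : F.moveFactor k i w.tail = 0 => hi ?_, rfl⟩
      simp only [moveFactor, h, map_zero]

theorem current_vacuum {k : ℤ} (hk : 0 < k) {w : NormalWedge} (hw : w.IsVacuum) :
    F.current k (Finsupp.single w 1) = 0 := by
  simp [current, F.moveFactor_vacuum hk _ hw]

theorem current_wedge_of_mem {k : ℤ} (hk : 0 < k) {p : ℤ} {v : FockSpace K}
    (hv : v ∈ firstLT K p) :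
    F.current k (F.wedge p v) = F.wedge (p - k * n) v + F.wedge p (F.current k v) := by
  refine eqOn_firstLT (f := F.current k ∘ₗ F.wedge p)
    (g := F.wedge (p - k * n) + F.wedge p ∘ₗ F.current k) (fun w hw => ?_) v hv
  simp only [LinearMap.comp_apply, LinearMap.add_apply, F.wedge_single_of_lt hw, current,
    Finsupp.linearCombination_single, one_smul]
  rw [finsum_eq_zero_add (F.hasFiniteSupport_moveFactor hk _),
    map_finsum (F.wedge p) (F.hasFiniteSupport_moveFactor hk w)]
  rfl

theorem current_mem_firstLT {k : ℤ} (hk : 0 < k) {c : ℤ} {v : FockSpace K}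
    (hv : v ∈ firstLT K c) : F.current k v ∈ firstLT K c := by
  suffices hle : firstLT K c ≤ (firstLT K c).comap (F.current k) from hle hv
  clear hv
  refine firstLT_le fun w hw => Submodule.mem_comap.2 ?_
  induction w using NormalWedge.induction_tail generalizing c with
  | vacuum w hw' => rw [F.current_vacuum hk hw']; exact Submodule.zero_mem _
  | cons w ih =>
    have hm := single_mem_firstLT w.tail_lt (1 : K)
    have hkn : 0 < k * n := mul_pos hk (Int.natCast_pos.2 (NeZero.pos n))
    rw [← F.wedge_single_tail w, F.current_wedge_of_mem hk hm]
    exact Submodule.add_mem _ (F.wedge_mem_firstLT (by omega) (firstLT_mono hw.le hm))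
      (F.wedge_mem_firstLT hw (firstLT_mono hw.le (ih w.tail_lt)))

theorem current_one_wedge_of_mem {p : ℤ} {v : FockSpace K} (hv : v ∈ firstLT K p) :
    F.current 1 (F.wedge p v) = F.wedge (p - n) v + F.wedge p (F.current 1 v) := by
  simpa using F.current_wedge_of_mem one_pos hv

theorem current_one_mem_firstLT {c : ℤ} {v : FockSpace K} (hv : v ∈ firstLT K c) :
    F.current 1 v ∈ firstLT K c :=
  F.current_mem_firstLT one_pos hv

end MetaplecticData

/-! ## Exchange of factors with close indices -/

namespace MetaplecticData

variable {n : ℕ} {K : Type*} [Field K] (F : MetaplecticData n K)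

theorem g_mul_g_neg {a : ZMod n} (ha : a ≠ 0) : F.g a * F.g (-a) = F.q ^ 2 := by
  simp only [g, ha, neg_eq_zero, if_false]
  linear_combination F.q ^ 2 * F.α_mul_neg a

theorem intCast_ne_zero_of_lt {a : ℤ} (h0 : 0 < a) (h1 : a < n) : (a : ZMod n) ≠ 0 := by
  rw [Ne, ZMod.intCast_zmod_eq_zero_iff_dvd]
  exact fun h => absurd (Int.le_of_dvd h0 h) (by omega)

theorem g_sub_mul_g_sub {a b : ℤ} (h0 : a < b) (h1 : b < a + n) :
    F.g ((a - b : ℤ) : ZMod n) * F.g ((b - a : ℤ) : ZMod n) = F.q ^ 2 := by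
  have hne := intCast_ne_zero_of_lt (n := n) (a := b - a) (by omega) (by omega)
  rw [mul_comm, ← F.g_mul_g_neg hne, ← Int.cast_neg, neg_sub]

section NormalOrder

variable {E : Type*} [AddCommGroup E] [Module K E]

theorem normalOrder_of_lt_add {l m : ℤ} (h0 : l < m) (h1 : m < l + n) (U : ℤ → ℤ → E) :
    F.normalOrder l m U = F.g ((l - m : ℤ) : ZMod n) • U m l := by
  have hi : (m - l) % (n : ℤ) = m - l := Int.emod_eq_of_lt (by omega) (by omega)
  rw [F.normalOrder_of_emod_ne_zero (by omega), hi, Finset.sum_eq_zero, smul_zero, add_zero]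
  intro t _
  have ht : (0 : ℤ) ≤ t * n := by positivity
  rw [if_neg (by omega), if_neg (by linarith), add_zero, smul_zero]

theorem normalOrder_add_natCast (l : ℤ) (U : ℤ → ℤ → E) :
    F.normalOrder l (l + n) U = -U (l + n) l :=
  F.normalOrder_of_emod_eq_zero (by simp) U

theorem normalOrder_of_lt_add_two_mul {l m : ℤ} (h0 : l + n < m) (h1 : m < l + 2 * n)
    (U : ℤ → ℤ → E) :
    F.normalOrder l m U =
      F.g ((l - m : ℤ) : ZMod n) • U m l + (F.q ^ 2 - 1) • U (l + n) (m - n) := by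
  have hi : (m - l) % (n : ℤ) = m - l - n := by
    rw [← Int.sub_emod_right]
    exact Int.emod_eq_of_lt (by omega) (by omega)
  have hsum_pos : 0 < (m - l).toNat := by omega
  rw [F.normalOrder_of_emod_ne_zero (by omega), hi,
    Finset.sum_eq_single_of_mem 0 (Finset.mem_range.2 hsum_pos)]
  · rw [if_pos (by push_cast; linarith), if_neg (by push_cast; linarith)]
    simp only [pow_zero, one_smul, add_zero, Nat.cast_zero, zero_mul, sub_zero]
    congr 3 <;> ring
  · intro t _ ht
    have ht : (1 : ℤ) ≤ t := by omega
    have htn : (n : ℤ) ≤ t * n := by nlinarith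
    rw [if_neg (by linarith), if_neg (by linarith), add_zero, smul_zero]

end NormalOrder

theorem wedge_wedge_of_lt_add {l m : ℤ} (h0 : l < m) (h1 : m < l + n) {v : FockSpace K}
    (hv : v ∈ firstLT K m) :
    F.wedge l (F.wedge m v) = F.g ((l - m : ℤ) : ZMod n) • F.wedge m (F.wedge l v) := by
  rw [F.wedge_wedge_of_mem h0 hv, F.normalOrder_of_lt_add h0 h1]

theorem wedge_wedge_of_lt_add_two_mul {l m : ℤ} (h0 : l + n < m) (h1 : m < l + 2 * n)
    {v : FockSpace K} (hv : v ∈ firstLT K m) :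
    F.wedge l (F.wedge m v) = F.g ((l - m : ℤ) : ZMod n) • F.wedge m (F.wedge l v) +
      (F.q ^ 2 - 1) • F.wedge (l + n) (F.wedge (m - n) v) := by
  rw [F.wedge_wedge_of_mem (by omega) hv, F.normalOrder_of_lt_add_two_mul h0 h1]

theorem wedge_wedge_of_mem_left_add {a b : ℤ} (h0 : a < b) (h1 : b < a + n) {v : FockSpace K}
    (hv : v ∈ firstLT K (a + n)) :
    F.wedge a (F.wedge b v) = F.g ((a - b : ℤ) : ZMod n) • F.wedge b (F.wedge a v) := by
  refine F.eqOn_firstLT_of_wedge (f := F.wedge a ∘ₗ F.wedge b)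
    (g := F.g ((a - b : ℤ) : ZMod n) • (F.wedge b ∘ₗ F.wedge a)) (d := b)
    (fun v hv => F.wedge_wedge_of_lt_add h0 h1 hv) (fun p hp hpa ih v hv => ?_) v hv
  simp only [LinearMap.comp_apply, LinearMap.smul_apply] at ih ⊢
  rcases hp.eq_or_lt with rfl | hp
  · rw [F.wedge_wedge_self_of_mem hv, map_zero, F.wedge_wedge_of_lt_add h0 h1 hv, map_smul,
      F.wedge_wedge_self_of_mem (F.wedge_mem_firstLT h0 hv), smul_zero, smul_zero]
  · rw [F.wedge_wedge_of_lt_add hp (by omega) hv,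
      F.wedge_wedge_of_lt_add (by omega) (by omega) hv, map_smul, map_smul,
      F.wedge_wedge_of_lt_add (by omega) (by omega) (F.wedge_mem_firstLT hp hv),
      F.wedge_wedge_of_lt_add hp (by omega) (F.wedge_mem_firstLT (by omega) hv), ih v hv,
      map_smul]
    module

theorem wedge_wedge_self_of_mem_add {a : ℤ} {v : FockSpace K} (hv : v ∈ firstLT K (a + n)) :
    F.wedge a (F.wedge a v) = 0 := by
  refine F.eqOn_firstLT_of_wedge (f := F.wedge a ∘ₗ F.wedge a) (g := 0) (d := a)
    (fun v hv => F.wedge_wedge_self_of_mem hv) (fun p hp hpa ih v hv => ?_) v hv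
  simp only [LinearMap.comp_apply, LinearMap.zero_apply] at ih ⊢
  rcases hp.eq_or_lt with rfl | hp
  · rw [F.wedge_wedge_self_of_mem hv, map_zero]
  · rw [F.wedge_wedge_of_lt_add hp (by omega) hv, map_smul,
      F.wedge_wedge_of_lt_add hp (by omega) (F.wedge_mem_firstLT hp hv), ih v hv, map_zero,
      smul_zero, smul_zero]

variable [NeZero n]

theorem wedge_sub_wedge_of_mem {m : ℤ} {v : FockSpace K} (hv : v ∈ firstLT K m) :
    F.wedge (m - n) (F.wedge m v) = -F.wedge m (F.wedge (m - n) v) := by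
  have hn : (0 : ℤ) < n := Int.natCast_pos.2 (NeZero.pos n)
  have h := F.normalOrder_add_natCast (m - n) fun a b => F.wedge a (F.wedge b v)
  rwa [sub_add_cancel, ← F.wedge_wedge_of_mem (by omega) hv] at h

theorem current_one_wedge_of_mem_add {l : ℤ} {v : FockSpace K} (hv : v ∈ firstLT K (l + n)) :
    F.current 1 (F.wedge l v) = F.wedge (l - n) v + F.wedge l (F.current 1 v) := by
  refine F.eqOn_firstLT_of_wedge (f := F.current 1 ∘ₗ F.wedge l)
    (g := F.wedge (l - n) + F.wedge l ∘ₗ F.current 1) (d := l)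
    (fun v hv => F.current_one_wedge_of_mem hv) (fun p hp hpl ih v hv => ?_) v hv
  simp only [LinearMap.comp_apply, LinearMap.add_apply] at ih ⊢
  rw [F.current_one_wedge_of_mem hv]
  rcases hp.eq_or_lt with rfl | hp
  · rw [F.wedge_wedge_self_of_mem hv, map_zero, F.wedge_sub_wedge_of_mem hv, map_add,
      F.wedge_wedge_self_of_mem (F.current_one_mem_firstLT hv)]
    abel
  · have exchange_moved_p : F.wedge (p - n) (F.wedge l v) =
        F.g ((p - l : ℤ) : ZMod n) • F.wedge l (F.wedge (p - n) v) := by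
      rw [F.wedge_wedge_of_mem_left_add (by omega) (by omega) (by simpa using hv),
        show p - n - l = p - l - n by ring]
      simp
    have exchange_moved_l : F.wedge (l - n) (F.wedge p v) =
        F.g ((l - p : ℤ) : ZMod n) • F.wedge p (F.wedge (l - n) v) +
          (F.q ^ 2 - 1) • F.wedge l (F.wedge (p - n) v) := by
      rw [F.wedge_wedge_of_lt_add_two_mul (by omega) (by omega) hv,
        show l - n - p = l - p - n by ring]
      simp
    rw [F.wedge_wedge_of_lt_add hp (by omega) hv, map_smul,
      F.current_one_wedge_of_mem (F.wedge_mem_firstLT hp hv), ih v hv, map_add, map_add,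
      exchange_moved_p, exchange_moved_l,
      F.wedge_wedge_of_lt_add hp (by omega) (F.current_one_mem_firstLT hv), smul_add, smul_smul,
      F.g_sub_mul_g_sub hp hpl]
    module

theorem wedge_wedge_of_mem_right_add {a b : ℤ} (h0 : a < b) (h1 : b < a + n) {v : FockSpace K}
    (hv : v ∈ firstLT K (b + n)) :
    F.wedge a (F.wedge b v) = F.g ((a - b : ℤ) : ZMod n) • F.wedge b (F.wedge a v) := by
  refine F.eqOn_firstLT_of_wedge (f := F.wedge a ∘ₗ F.wedge b)
    (g := F.g ((a - b : ℤ) : ZMod n) • (F.wedge b ∘ₗ F.wedge a)) (d := a + n)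
    (fun v hv => F.wedge_wedge_of_mem_left_add h0 h1 hv) (fun r hr hrb ih v hv => ?_) v hv
  simp only [LinearMap.comp_apply, LinearMap.smul_apply] at ih ⊢
  have hbr : b < r := by omega
  have hbv := F.wedge_mem_firstLT hbr hv
  rw [F.wedge_wedge_of_lt_add hbr hrb hv, map_smul]
  rcases hr.eq_or_lt with rfl | hr
  · have exchange_a_r {u : FockSpace K} (hu : u ∈ firstLT K (a + n)) :
        F.wedge a (F.wedge (a + n) u) = -F.wedge (a + n) (F.wedge a u) := by
      simpa using F.wedge_sub_wedge_of_mem hu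
    rw [exchange_a_r hbv, exchange_a_r hv, map_neg,
      F.wedge_wedge_of_lt_add hbr hrb (F.wedge_mem_firstLT (by omega) hv), ih v hv, map_smul]
    module
  · have exchange_moved_r : F.wedge (r - n) (F.wedge b v) =
        F.g ((r - b : ℤ) : ZMod n) • F.wedge b (F.wedge (r - n) v) := by
      rw [F.wedge_wedge_of_mem_left_add (by omega) (by omega) (by simpa using hv),
        show r - n - b = r - b - n by ring]
      simp
    have exchange_moved_a : F.wedge b (F.wedge (a + n) (F.wedge (r - n) v)) =
        F.g ((b - a : ℤ) : ZMod n) • F.wedge (a + n) (F.wedge b (F.wedge (r - n) v)) := by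
      rw [F.wedge_wedge_of_mem_left_add (by omega) (by omega)
        (F.wedge_mem_firstLT (by omega) (firstLT_mono hrb.le hv)),
        show b - (a + n) = b - a - n by ring]
      simp
    have coeff_eq : F.g ((b - r : ℤ) : ZMod n) * ((F.q ^ 2 - 1) * F.g ((r - b : ℤ) : ZMod n)) =
        F.g ((a - b : ℤ) : ZMod n) * ((F.q ^ 2 - 1) * F.g ((b - a : ℤ) : ZMod n)) := by
      linear_combination (F.q ^ 2 - 1) * (F.g_sub_mul_g_sub hbr hrb - F.g_sub_mul_g_sub h0 h1)
    rw [F.wedge_wedge_of_lt_add_two_mul hr (by omega) hbv,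
      F.wedge_wedge_of_lt_add_two_mul hr (by omega) hv, map_add, map_smul, map_smul,
      F.wedge_wedge_of_lt_add hbr hrb (F.wedge_mem_firstLT (by omega) hv), ih v hv,
      exchange_moved_r, exchange_moved_a, map_smul, map_smul]
    simp only [smul_add, smul_smul]
    rw [coeff_eq]
    module

/-! ## The second elementary symmetric function of the currents -/

/-- The operator `(J₁² - J₂) / 2`.  As `J_k` is the `k`-th power sum of the operators moving a
single factor by `n`, this is their second elementary symmetric function: it moves two distinct
factors by `n`. -/
noncomputable def currentE₂ : FockSpace K →ₗ[K] FockSpace K :=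
  (2 : K)⁻¹ • (F.current 1 ∘ₗ F.current 1 - F.current 2)

theorem currentE₂_mem_firstLT {c : ℤ} {v : FockSpace K} (hv : v ∈ firstLT K c) :
    F.currentE₂ v ∈ firstLT K c :=
  Submodule.smul_mem _ _ (Submodule.sub_mem _
    (F.current_one_mem_firstLT (F.current_one_mem_firstLT hv)) (F.current_mem_firstLT two_pos hv))

variable [CharZero K]

theorem currentE₂_wedge_of_mem {p : ℤ} {v : FockSpace K} (hv : v ∈ firstLT K p) :
    F.currentE₂ (F.wedge p v) =
      F.wedge p (F.currentE₂ v) + F.wedge (p - n) (F.current 1 v) := by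
  have current_two := F.current_wedge_of_mem two_pos hv
  rw [show p - 2 * (n : ℤ) = p - n - n by ring] at current_two
  simp only [currentE₂, LinearMap.smul_apply, LinearMap.sub_apply, LinearMap.comp_apply,
    F.current_one_wedge_of_mem hv, current_two, map_add, map_sub, map_smul,
    F.current_one_wedge_of_mem_add (l := p - n) (v := v) (by simpa using hv),
    F.current_one_wedge_of_mem (F.current_one_mem_firstLT hv)]
  module

theorem currentE₂_wedge_of_mem_add {l : ℤ} {v : FockSpace K} (hv : v ∈ firstLT K (l + n)) :
    F.currentE₂ (F.wedge l v) =
      F.wedge l (F.currentE₂ v) + F.wedge (l - n) (F.current 1 v) := by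
  refine F.eqOn_firstLT_of_wedge (f := F.currentE₂ ∘ₗ F.wedge l)
    (g := F.wedge l ∘ₗ F.currentE₂ + F.wedge (l - n) ∘ₗ F.current 1) (d := l)
    (fun v hv => F.currentE₂_wedge_of_mem hv) (fun p hp hpl ih v hv => ?_) v hv
  simp only [LinearMap.comp_apply, LinearMap.add_apply] at ih ⊢
  have hJv := F.current_one_mem_firstLT hv
  rw [F.current_one_wedge_of_mem hv, F.currentE₂_wedge_of_mem hv]
  rcases hp.eq_or_lt with rfl | hp
  · rw [F.wedge_wedge_self_of_mem hv, map_zero, map_add, map_add,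
      F.wedge_wedge_self_of_mem (F.currentE₂_mem_firstLT hv), F.wedge_sub_wedge_of_mem hJv,
      F.wedge_wedge_self_of_mem_add (by simpa using hv)]
    abel
  · have exchange_moved_p : F.wedge (p - n) (F.wedge l (F.current 1 v)) =
        F.g ((p - l : ℤ) : ZMod n) • F.wedge l (F.wedge (p - n) (F.current 1 v)) := by
      rw [F.wedge_wedge_of_mem_left_add (by omega) (by omega) (by simpa using hJv),
        show p - n - l = p - l - n by ring]
      simp
    have exchange_moved_l : F.wedge (l - n) (F.wedge p (F.current 1 v)) =
        F.g ((l - p : ℤ) : ZMod n) • F.wedge p (F.wedge (l - n) (F.current 1 v)) +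
          (F.q ^ 2 - 1) • F.wedge l (F.wedge (p - n) (F.current 1 v)) := by
      rw [F.wedge_wedge_of_lt_add_two_mul (by omega) (by omega) hJv,
        show l - n - p = l - p - n by ring]
      simp
    have exchange_moved_both : F.wedge (l - n) (F.wedge (p - n) v) =
        F.g ((l - p : ℤ) : ZMod n) • F.wedge (p - n) (F.wedge (l - n) v) := by
      rw [F.wedge_wedge_of_mem_right_add (by omega) (by omega) (by simpa using hv),
        sub_sub_sub_cancel_right]
    rw [F.wedge_wedge_of_lt_add hp (by omega) hv, map_smul,
      F.currentE₂_wedge_of_mem (F.wedge_mem_firstLT hp hv), ih v hv,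
      F.current_one_wedge_of_mem_add (firstLT_mono hpl.le hv)]
    simp only [map_add]
    rw [exchange_moved_p, exchange_moved_l, exchange_moved_both,
      F.wedge_wedge_of_lt_add hp (by omega) (F.currentE₂_mem_firstLT hv)]
    simp only [smul_add, smul_smul, F.g_sub_mul_g_sub hp hpl]
    module

theorem current_one_currentE₂ (v : FockSpace K) :
    F.current 1 (F.currentE₂ v) = F.currentE₂ (F.current 1 v) := by
  suffices h : F.current 1 ∘ₗ F.currentE₂ = F.currentE₂ ∘ₗ F.current 1 from LinearMap.congr_fun h v
  refine F.linearMap_ext_of_wedge (fun w hw => ?_) fun p v hv ih => ?_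
  · simp [currentE₂, F.current_vacuum one_pos hw, F.current_vacuum two_pos hw]
  · simp only [LinearMap.comp_apply] at ih ⊢
    have hJv := F.current_one_mem_firstLT hv
    rw [F.currentE₂_wedge_of_mem hv, map_add,
      F.current_one_wedge_of_mem (F.currentE₂_mem_firstLT hv),
      F.current_one_wedge_of_mem_add (by simpa using hJv), ih,
      F.current_one_wedge_of_mem hv, map_add, F.currentE₂_wedge_of_mem hJv,
      F.currentE₂_wedge_of_mem_add (by simpa using hv)]
    abel

end MetaplecticData

/-! ## Moving a factor of a normally ordered pair -/

namespace MetaplecticData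

variable {n : ℕ} {K : Type*} [Field K] (F : MetaplecticData n K) [NeZero n]
  {E : Type*} [AddCommGroup E] [Module K E]

theorem normalOrder_eq_sum_range {l m : ℤ} (hlm : (m - l) % n ≠ 0) {R : ℕ}
    (hR : (m - l).toNat ≤ R) (U : ℤ → ℤ → E) :
    F.normalOrder l m U = F.g ((l - m : ℤ) : ZMod n) • U m l +
      (F.q ^ 2 - 1) • ∑ t ∈ Finset.range R, (F.q ^ 2) ^ t •
      ((if l + (m - l) % n + t * n < m - (m - l) % n - t * n then
          U (m - (m - l) % n - t * n) (l + (m - l) % n + t * n) else 0) +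
        (if l + (t + 1) * n < m - (t + 1) * n then
          F.g ((l - m : ℤ) : ZMod n) • U (m - (t + 1) * n) (l + (t + 1) * n) else 0)) := by
  have hn : (1 : ℤ) ≤ n := Int.natCast_pos.2 (NeZero.pos n)
  rw [F.normalOrder_of_emod_ne_zero hlm]
  congr 2
  refine Finset.sum_subset (Finset.range_subset_range.2 hR) fun t _ ht => ?_
  have hi : 0 ≤ (m - l) % (n : ℤ) := Int.emod_nonneg _ (by omega)
  have htn : (t : ℤ) ≤ t * n := le_mul_of_one_le_right (Int.natCast_nonneg t) hn
  have ht : m - l ≤ t := Int.toNat_le.1 (not_lt.1 (Finset.mem_range.not.1 ht))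
  rw [if_neg (by linarith), if_neg (by linarith), add_zero, smul_zero]

theorem normalOrder_of_add_two_mul_lt {l m i : ℤ} (hlm : l + 2 * n < m)
    (hi : (m - l) % n = i) (hi0 : i ≠ 0) (U : ℤ → ℤ → E) :
    F.normalOrder l m U = F.q ^ 2 • F.normalOrder (l + n) (m - n) U +
      F.g ((l - m : ℤ) : ZMod n) • (U m l - U (m - n) (l + n)) +
      (F.q ^ 2 - 1) • U (m - i) (l + i) := by
  have hn : (0 : ℤ) < n := Int.natCast_pos.2 (NeZero.pos n)
  have hin : i < n := hi ▸ Int.emod_lt_of_pos _ hn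
  have hi' : (m - n - (l + n)) % (n : ℤ) = i := by
    rw [← hi, show m - n - (l + n) = m - l - n - n by ring, Int.sub_emod_right, Int.sub_emod_right]
  have hg : ((l + n - (m - n) : ℤ) : ZMod n) = ((l - m : ℤ) : ZMod n) := by simp
  have inner_index (t : ℕ) :
      m - n - i - t * n = m - i - (t + 1 : ℕ) * n ∧ l + n + i + t * n = l + i + (t + 1 : ℕ) * n ∧
      m - n - (t + 1) * n = m - ((t + 1 : ℕ) + 1) * n ∧
      l + n + (t + 1) * n = l + ((t + 1 : ℕ) + 1) * n := by
    refine ⟨?_, ?_, ?_, ?_⟩ <;> push_cast <;> ring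
  rw [F.normalOrder_eq_sum_range (R := (m - l).toNat + 1) (by omega) (Nat.le_succ _),
    F.normalOrder_eq_sum_range (l := l + n) (R := (m - l).toNat) (by omega) (by omega),
    Finset.sum_range_succ', hi, hi', hg, if_pos (by push_cast; linarith),
    if_pos (by push_cast; linarith)]
  simp only [inner_index, pow_succ', mul_smul, ← Finset.smul_sum, Nat.cast_zero, zero_mul, sub_zero,
    add_zero, zero_add, one_mul, pow_zero, one_smul]
  module

theorem normalOrder_move_of_lt_add_two_mul {m p : ℤ} (hmp : m + n < p) (hpm : p < m + 2 * n)
    {U : ℤ → ℤ → E} (hU : U m (p - n) = F.g ((m - (p - n) : ℤ) : ZMod n) • U (p - n) m) :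
    F.normalOrder m p (fun a b => U (a - n) b + U a (b - n)) =
      F.normalOrder (m - n) p U + F.normalOrder m (p - n) U := by
  have hi : (p - (m - n)) % (n : ℤ) = p - m - n := by
    rw [show p - (m - n) = p - m - n + n + n by ring, Int.add_emod_right, Int.add_emod_right]
    exact Int.emod_eq_of_lt (by omega) (by omega)
  rw [F.normalOrder_of_lt_add_two_mul hmp hpm,
    F.normalOrder_of_add_two_mul_lt (by omega) hi (by omega), sub_add_cancel,
    F.normalOrder_of_lt_add (by omega) (by omega), add_sub_cancel_right,
    show p - (p - m - n) = m + n by ring, show m - n + (p - m - n) = p - n - n by ring, hU,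
    show m - (p - n) = m - p + n by ring, show m - n - p = m - p - n by ring]
  simp only [Int.cast_add, Int.cast_sub, Int.cast_natCast, CharP.cast_eq_zero, add_zero, sub_zero]
  module

theorem normalOrder_move_of_lt_add_three_mul {m p : ℤ} (hmp : m + 2 * n < p)
    (hpm : p < m + 3 * n) {U : ℤ → ℤ → E}
    (hU : U (p - n - n) (m + n) =
      F.g ((p - n - n - (m + n) : ℤ) : ZMod n) • U (m + n) (p - n - n)) :
    F.normalOrder m p (fun a b => U (a - n) b + U a (b - n)) =
      F.normalOrder (m - n) p U + F.normalOrder m (p - n) U := by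
  have hi : (p - m) % (n : ℤ) = p - m - n - n := by
    rw [← Int.sub_emod_right, ← Int.sub_emod_right]
    exact Int.emod_eq_of_lt (by omega) (by omega)
  have hi' : (p - (m - n)) % (n : ℤ) = p - m - n - n := by
    rw [← hi, show p - (m - n) = p - m + n by ring, Int.add_emod_right]
  have hg := F.g_sub_mul_g_sub (a := p - n - n) (b := m + n) (by omega) (by omega)
  rw [F.normalOrder_of_add_two_mul_lt hmp hi (by omega),
    F.normalOrder_of_add_two_mul_lt (by omega) hi' (by omega), sub_add_cancel,
    F.normalOrder_of_lt_add (by omega) (by omega),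
    F.normalOrder_of_lt_add_two_mul (by omega) (by omega),
    show p - (p - m - n - n) = m + n + n by ring, show m + (p - m - n - n) = p - n - n by ring,
    show m - n + (p - m - n - n) = p - n - n - n by ring, hU]
  simp only [add_sub_cancel_right]
  push_cast at hg ⊢
  simp only [CharP.cast_eq_zero, add_zero, sub_zero] at hg ⊢
  linear_combination (norm := module) (F.q ^ 2 - 1) • hg • U (m + n) (p - n - n)

theorem normalOrder_move {m p : ℤ} (hmp : m + n < p) {U : ℤ → ℤ → E}
    (hU : ∀ x y : ℤ, y < x → x < y + n → x + y = m + p - n →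
      U y x = F.g ((y - x : ℤ) : ZMod n) • U x y) :
    F.normalOrder m p (fun a b => U (a - n) b + U a (b - n)) =
      F.normalOrder (m - n) p U + F.normalOrder m (p - n) U := by
  have hi₂ : (p - (m - n)) % (n : ℤ) = (p - m) % n := by
    rw [show p - (m - n) = p - m + n by ring, Int.add_emod_right]
  have hi₃ : (p - n - m) % (n : ℤ) = (p - m) % n := by
    rw [show p - n - m = p - m - n by ring, Int.sub_emod_right]
  by_cases hi : (p - m) % (n : ℤ) = 0
  · rw [F.normalOrder_of_emod_eq_zero hi, F.normalOrder_of_emod_eq_zero (by rw [hi₂, hi]),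
      F.normalOrder_of_emod_eq_zero (by rw [hi₃, hi])]
    abel
  have hne (k : ℤ) : p ≠ m + k * n := fun h => hi (by simp [h])
  have hne₂ := hne 2
  have hne₃ := hne 3
  rcases lt_or_ge p (m + 2 * n) with hpm | hpm
  · exact F.normalOrder_move_of_lt_add_two_mul hmp hpm (hU _ _ (by omega) (by omega) (by ring))
  rcases lt_or_ge p (m + 3 * n) with hpm | hpm
  · exact F.normalOrder_move_of_lt_add_three_mul (by omega) hpm
      (hU _ _ (by omega) (by omega) (by ring))
  have ih := normalOrder_move (m := m + n) (p := p - n) (by omega)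
    fun x y h0 h1 h => hU x y h0 h1 (by linarith)
  rw [add_sub_cancel_right] at ih
  rw [F.normalOrder_of_add_two_mul_lt (by omega) rfl hi, ih,
    F.normalOrder_of_add_two_mul_lt (l := m - n) (by omega) hi₂ hi, sub_add_cancel,
    F.normalOrder_of_add_two_mul_lt (m := p - n) (by omega) hi₃ hi]
  push_cast
  simp only [CharP.cast_eq_zero, sub_zero, sub_add_cancel,
    sub_right_comm p _ (n : ℤ), add_sub_right_comm m _ (n : ℤ)]
  module
termination_by (p - m).toNat
decreasing_by have := NeZero.pos n; omega

end MetaplecticData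

/-! ## Exchange of arbitrary factors -/

namespace MetaplecticData

variable {n : ℕ} {K : Type*} [Field K] (F : MetaplecticData n K)

/-- The commutation relations of `u_m` with `J₁` and `(J₁² - J₂) / 2`, for all `m`, on wedges with
first index less than `m + k`. -/
def CommutesBelow (k : ℤ) : Prop :=
  ∀ m, ∀ v ∈ firstLT K (m + k),
    F.current 1 (F.wedge m v) = F.wedge (m - n) v + F.wedge m (F.current 1 v) ∧
    F.currentE₂ (F.wedge m v) = F.wedge m (F.currentE₂ v) + F.wedge (m - n) (F.current 1 v)

namespace CommutesBelow

variable {F} {k : ℤ} (hk : F.CommutesBelow k) {l m c : ℤ}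
include hk

theorem current_one_wedge_wedge (hml : m < l + k) (hl : c ≤ l + k) (hm : c ≤ m + k)
    {v : FockSpace K} (hv : v ∈ firstLT K c) :
    F.current 1 (F.wedge l (F.wedge m v)) =
      (F.wedge (l - n) (F.wedge m v) + F.wedge l (F.wedge (m - n) v)) +
        F.wedge l (F.wedge m (F.current 1 v)) := by
  rw [(hk l _ (F.wedge_mem_firstLT hml (firstLT_mono hl hv))).1,
    (hk m v (firstLT_mono hm hv)).1, map_add, add_assoc]

theorem currentE₂_wedge_wedge (hml : m < l + k) (hl : c ≤ l + k) (hm : c ≤ m + k)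
    {v : FockSpace K} (hv : v ∈ firstLT K c) :
    F.currentE₂ (F.wedge l (F.wedge m v)) =
      (F.wedge (l - n) (F.wedge (m - n) v) +
        (F.wedge (l - n) (F.wedge m (F.current 1 v)) +
          F.wedge l (F.wedge (m - n) (F.current 1 v)))) +
        F.wedge l (F.wedge m (F.currentE₂ v)) := by
  rw [(hk l _ (F.wedge_mem_firstLT hml (firstLT_mono hl hv))).2,
    (hk m v (firstLT_mono hm hv)).1, (hk m v (firstLT_mono hm hv)).2, map_add, map_add]
  abel

variable [NeZero n]

theorem wedge_wedge_move (hlm : l < m) (hml : m < l + k) (hc : c ≤ l + k)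
    (h : ∀ u ∈ firstLT K c,
      F.wedge l (F.wedge m u) = F.normalOrder l m fun a b => F.wedge a (F.wedge b u))
    {u : FockSpace K} (hu : u ∈ firstLT K c) :
    F.wedge (l - n) (F.wedge m u) + F.wedge l (F.wedge (m - n) u) =
      F.normalOrder l m fun a b =>
        F.wedge (a - n) (F.wedge b u) + F.wedge a (F.wedge (b - n) u) := by
  have hJ := congrArg (F.current 1) (h u hu)
  rw [F.map_normalOrder, F.normalOrder_congr hlm fun a b hlb hba _ _ =>
      hk.current_one_wedge_wedge (by omega) (by omega) (by omega) hu,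
    F.normalOrder_add, ← h _ (F.current_one_mem_firstLT hu),
    hk.current_one_wedge_wedge hml hc (by omega) hu] at hJ
  exact add_right_cancel hJ

theorem wedge_sub_wedge_sub (hlm : l < m) (hml : m < l + k) (hc : c ≤ l + k)
    (h : ∀ u ∈ firstLT K c,
      F.wedge l (F.wedge m u) = F.normalOrder l m fun a b => F.wedge a (F.wedge b u))
    {u : FockSpace K} (hu : u ∈ firstLT K c) :
    F.wedge (l - n) (F.wedge (m - n) u) =
      F.normalOrder (l - n) (m - n) fun a b => F.wedge a (F.wedge b u) := by
  have hE := congrArg F.currentE₂ (h u hu)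
  rw [F.map_normalOrder, F.normalOrder_congr hlm fun a b hlb hba _ _ =>
      hk.currentE₂_wedge_wedge (by omega) (by omega) (by omega) hu,
    F.normalOrder_add, ← h _ (F.currentE₂_mem_firstLT hu), F.normalOrder_add,
    ← hk.wedge_wedge_move hlm hml hc h (F.current_one_mem_firstLT hu),
    hk.currentE₂_wedge_wedge hml hc (by omega) hu] at hE
  rw [F.normalOrder_sub_sub]
  exact add_right_cancel (add_right_cancel hE)

theorem wedge_wedge {l m : ℤ} (hlm : l < m) (hml : m < l + k) (hc : c ≤ l + n + k)
    {v : FockSpace K} (hv : v ∈ firstLT K c) :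
    F.wedge l (F.wedge m v) = F.normalOrder l m fun a b => F.wedge a (F.wedge b v) := by
  rcases le_or_gt c m with hcm | hcm
  · exact F.wedge_wedge_of_mem hlm (firstLT_mono hcm hv)
  · have exchange_add (u) (hu : u ∈ firstLT K c) :
        F.wedge (l + n) (F.wedge (m + n) u) =
          F.normalOrder (l + n) (m + n) fun a b => F.wedge a (F.wedge b u) :=
      wedge_wedge (by omega) (by omega) (by omega) hu
    have exchange := hk.wedge_sub_wedge_sub (by omega) (by omega) hc exchange_add hv
    rwa [add_sub_cancel_right, add_sub_cancel_right] at exchange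
termination_by (c - m).toNat
decreasing_by have := NeZero.pos n; omega

theorem normalOrder_wedge_move {v : FockSpace K} (hnk : n ≤ k) (hv : v ∈ firstLT K (m + k)) :
    F.normalOrder m (m + k) (fun a b =>
        F.wedge (a - n) (F.wedge b v) + F.wedge a (F.wedge (b - n) v)) =
      F.wedge (m - n) (F.wedge (m + k) v) + F.wedge m (F.wedge (m + k - n) v) := by
  have hn : (0 : ℤ) < n := Int.natCast_pos.2 (NeZero.pos n)
  rcases hnk.eq_or_lt with rfl | hnk
  · have hmod : (m + n - (m - n)) % (n : ℤ) = 0 := by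
      rw [show m + (n : ℤ) - (m - n) = 2 * n by ring, Int.mul_emod_left]
    rw [F.normalOrder_add_natCast, F.wedge_wedge_of_mem (by omega) hv,
      F.normalOrder_of_emod_eq_zero hmod, add_sub_cancel_right, F.wedge_wedge_self_of_mem_add hv]
    abel
  · rw [F.normalOrder_move (U := fun a b => F.wedge a (F.wedge b v)) (by omega),
      F.wedge_wedge_of_mem (by omega) hv,
      hk.wedge_wedge (by omega) (by omega) (by omega) hv]
    intro x y hyx hxy hsum
    rw [hk.wedge_wedge hyx (by omega) (by omega) hv, F.normalOrder_of_lt_add hyx hxy]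

theorem current_one_wedge {v : FockSpace K} (hnk : n ≤ k) (hv : v ∈ firstLT K (m + (k + 1))) :
    F.current 1 (F.wedge m v) = F.wedge (m - n) v + F.wedge m (F.current 1 v) := by
  have hn : (0 : ℤ) < n := Int.natCast_pos.2 (NeZero.pos n)
  refine F.eqOn_firstLT_of_wedge (f := F.current 1 ∘ₗ F.wedge m)
    (g := F.wedge (m - n) + F.wedge m ∘ₗ F.current 1) (d := m + k)
    (fun v hv => (hk m v hv).1) (fun p hp hpm _ v hv => ?_) v hv
  obtain rfl : p = m + k := by omega
  simp only [LinearMap.comp_apply, LinearMap.add_apply]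
  rw [F.wedge_wedge_of_mem (by omega) hv, F.map_normalOrder,
    F.normalOrder_congr (by omega) fun a b hmb hba _ _ =>
      hk.current_one_wedge_wedge (by omega) (by omega) (by omega) hv,
    F.normalOrder_add, ← F.wedge_wedge_of_mem (by omega) (F.current_one_mem_firstLT hv),
    hk.normalOrder_wedge_move hnk hv, F.current_one_wedge_of_mem hv, map_add, add_assoc]

variable [CharZero K]

theorem add_one (hnk : n ≤ k) : F.CommutesBelow (k + 1) := by
  intro m v hv
  have hn : (0 : ℤ) < n := Int.natCast_pos.2 (NeZero.pos n)
  have mem_shift {u : FockSpace K} (hu : u ∈ firstLT K (m + (k + 1))) :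
      u ∈ firstLT K (m + n + k) := firstLT_mono (by omega) hu
  have hJv := F.current_one_mem_firstLT hv
  have hEv := F.currentE₂_mem_firstLT hv
  have currentE₂_current_one : F.currentE₂ (F.current 1 (F.wedge (m + n) v)) =
      F.currentE₂ (F.wedge m v) + (F.wedge (m + n) (F.currentE₂ (F.current 1 v)) +
        F.wedge m (F.current 1 (F.current 1 v))) := by
    rw [(hk _ _ (mem_shift hv)).1, map_add, (hk _ _ (mem_shift hJv)).2, add_sub_cancel_right]
  have current_one_currentE₂ : F.current 1 (F.currentE₂ (F.wedge (m + n) v)) =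
      F.wedge m (F.currentE₂ v) + F.wedge (m + n) (F.current 1 (F.currentE₂ v)) +
        (F.wedge (m - n) (F.current 1 v) + F.wedge m (F.current 1 (F.current 1 v))) := by
    rw [(hk _ _ (mem_shift hv)).2, map_add, (hk _ _ (mem_shift hEv)).1, add_sub_cancel_right,
      hk.current_one_wedge hnk hJv]
  refine ⟨hk.current_one_wedge hnk hv, ?_⟩
  rw [F.current_one_currentE₂, currentE₂_current_one, F.current_one_currentE₂]
    at current_one_currentE₂
  linear_combination (norm := module) current_one_currentE₂

end CommutesBelow

variable [NeZero n] [CharZero K]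

theorem commutesBelow (k : ℤ) : F.CommutesBelow k := by
  have commutesBelow_add (j : ℕ) : F.CommutesBelow (n + j) := by
    induction j with
    | zero =>
      rw [Nat.cast_zero, add_zero]
      exact fun m v hv => ⟨F.current_one_wedge_of_mem_add hv, F.currentE₂_wedge_of_mem_add hv⟩
    | succ j ih => simpa [add_assoc] using ih.add_one (by omega)
  exact fun m v hv => commutesBelow_add (k - n).toNat m v (firstLT_mono (by omega) hv)

theorem wedge_wedge {l m : ℤ} (hlm : l < m) (v : FockSpace K) :
    F.wedge l (F.wedge m v) = F.normalOrder l m fun a b => F.wedge a (F.wedge b v) := by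
  obtain ⟨c, hc⟩ := exists_mem_firstLT v
  exact (F.commutesBelow (max (m - l + 1) (c - l - n))).wedge_wedge hlm (by omega) (by omega) hc

theorem current_one_wedge (m : ℤ) (v : FockSpace K) :
    F.current 1 (F.wedge m v) = F.wedge (m - n) v + F.wedge m (F.current 1 v) := by
  obtain ⟨c, hc⟩ := exists_mem_firstLT v
  exact (F.commutesBelow (c - m) m v (by simpa using hc)).1

end MetaplecticData

/-! ## Commutation relations of the currents -/

namespace MetaplecticData

variable {n : ℕ} {K : Type*} [Field K] (F : MetaplecticData n K) [NeZero n]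

theorem current_wedge_self {k : ℕ} (hk : 0 < k) {m : ℤ} {v : FockSpace K} (hv : v ∈ firstLT K m) :
    F.current k (F.wedge m (F.wedge m v)) =
      F.wedge (m - k * n) (F.wedge m v) + F.wedge m (F.current k (F.wedge m v)) := by
  have hk' : (0 : ℤ) < k := Int.natCast_pos.2 hk
  have hkn : (0 : ℤ) < k * n := mul_pos hk' (Int.natCast_pos.2 (NeZero.pos n))
  rw [F.current_wedge_of_mem hk' hv, F.wedge_wedge_self_of_mem hv, map_zero, map_add,
    F.wedge_wedge_self_of_mem (F.current_mem_firstLT hk' hv), F.wedge_wedge_of_mem (by omega) hv,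
    F.normalOrder_of_emod_eq_zero (by simp)]
  abel

variable [CharZero K]

/- With `P k a b = u_{a-kn} ∧ u_b ∧ v + u_a ∧ u_{b-kn} ∧ v`, which is a power sum in the operators
moving the two factors, Newton's identity `p_{k+2} = p₁ p_{k+1} - e₂ p_k` is used with `p₁` realized
by the current `J₁`. -/
theorem wedge_move_add_wedge_move (k : ℕ) {l m : ℤ} (hlm : l < m) (v : FockSpace K) :
    F.wedge (l - k * n) (F.wedge m v) + F.wedge l (F.wedge (m - k * n) v) =
      F.normalOrder l m fun a b =>
        F.wedge (a - k * n) (F.wedge b v) + F.wedge a (F.wedge (b - k * n) v) := by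
  induction k using Nat.twoStepInduction generalizing l m v with
  | zero => simp [F.normalOrder_add, F.wedge_wedge hlm]
  | one =>
    have move (a b : ℤ) :
        F.wedge (a - (1 : ℕ) * n) (F.wedge b v) + F.wedge a (F.wedge (b - (1 : ℕ) * n) v) =
          F.current 1 (F.wedge a (F.wedge b v)) - F.wedge a (F.wedge b (F.current 1 v)) := by
      simp only [Nat.cast_one, one_mul, F.current_one_wedge, map_add]
      abel
    simp only [move]
    rw [F.normalOrder_sub, ← F.map_normalOrder, ← F.wedge_wedge hlm, ← F.wedge_wedge hlm]
  | more k ih ih' =>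
    have move (a b : ℤ) :
        F.wedge (a - (k + 2 : ℕ) * n) (F.wedge b v) + F.wedge a (F.wedge (b - (k + 2 : ℕ) * n) v) =
          F.current 1 (F.wedge (a - (k + 1 : ℕ) * n) (F.wedge b v) +
            F.wedge a (F.wedge (b - (k + 1 : ℕ) * n) v)) -
          (F.wedge (a - (k + 1 : ℕ) * n) (F.wedge b (F.current 1 v)) +
            F.wedge a (F.wedge (b - (k + 1 : ℕ) * n) (F.current 1 v))) -
          (F.wedge (a - n - k * n) (F.wedge (b - n) v) +
            F.wedge (a - n) (F.wedge (b - n - k * n) v)) := by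
      simp only [map_add, F.current_one_wedge]
      push_cast
      ring_nf
      abel
    simp only [move]
    rw [F.normalOrder_sub, F.normalOrder_sub, ← F.map_normalOrder, ← ih' hlm, ← ih' hlm,
      ih (by omega), F.normalOrder_sub_sub]

theorem current_wedge_of_mem_add {k : ℕ} (hk : 0 < k) {j : ℕ} {m : ℤ} {v : FockSpace K}
    (hv : v ∈ firstLT K (m + j)) :
    F.current k (F.wedge m v) = F.wedge (m - k * n) v + F.wedge m (F.current k v) := by
  have hk' : (0 : ℤ) < k := Int.natCast_pos.2 hk
  induction j generalizing m v with
  | zero => exact F.current_wedge_of_mem hk' (by simpa using hv)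
  | succ j ih =>
    refine F.eqOn_firstLT_of_wedge (f := F.current k ∘ₗ F.wedge m)
      (g := F.wedge (m - k * n) + F.wedge m ∘ₗ F.current k) (d := m + j)
      (fun v hv => ih hv) (fun p hp hpm _ v hv => ?_) v hv
    obtain rfl : p = m + j := by omega
    simp only [LinearMap.comp_apply, LinearMap.add_apply]
    rcases j.eq_zero_or_pos with rfl | hj
    · simp only [Nat.cast_zero, add_zero] at hv ⊢
      exact F.current_wedge_self hk hv
    have hlt : m < m + j := by omega
    have current_wedge_wedge (a b : ℤ) (ha : m + j ≤ a + j) (hb : m + j ≤ b + j) (hba : b < a) :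
        F.current k (F.wedge a (F.wedge b v)) =
          (F.wedge (a - k * n) (F.wedge b v) + F.wedge a (F.wedge (b - k * n) v)) +
            F.wedge a (F.wedge b (F.current k v)) := by
      rw [ih (F.wedge_mem_firstLT (by omega) (firstLT_mono ha hv)), ih (firstLT_mono hb hv),
        map_add, add_assoc]
    rw [F.wedge_wedge hlt, F.map_normalOrder, F.normalOrder_congr hlt fun a b hmb hba _ _ =>
        current_wedge_wedge a b (by omega) (by omega) hba,
      F.normalOrder_add, ← F.wedge_move_add_wedge_move k hlt, ← F.wedge_wedge hlt,
      F.current_wedge_of_mem hk' hv, map_add, add_assoc]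

theorem current_wedge {k : ℕ} (hk : 0 < k) (m : ℤ) (v : FockSpace K) :
    F.current k (F.wedge m v) = F.wedge (m - k * n) v + F.wedge m (F.current k v) := by
  obtain ⟨c, hc⟩ := exists_mem_firstLT v
  exact F.current_wedge_of_mem_add hk (j := (c - m).toNat) (firstLT_mono (by omega) hc)

theorem current_comm {k l : ℕ} (hk : 0 < k) (hl : 0 < l) :
    F.current k ∘ₗ F.current l = F.current l ∘ₗ F.current k := by
  refine F.linearMap_ext_of_wedge (fun w hw => ?_) fun p v _ ih => ?_
  · simp [F.current_vacuum (Int.natCast_pos.2 hk) hw, F.current_vacuum (Int.natCast_pos.2 hl) hw]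
  · simp only [LinearMap.comp_apply] at ih ⊢
    simp only [F.current_wedge hk, F.current_wedge hl, map_add, ih]
    rw [sub_right_comm p (k * n : ℤ)]
    abel

end MetaplecticData

/-! ## Locally finite sums and exponentials of operators -/

section LocallyFinite

open Filter Finset

variable {K V : Type*} [Field K] [AddCommGroup V] [Module K V]

/-- The vectors that the operators of a family eventually annihilate along a filter. -/
def eventualKer {ι : Type*} (T : ι → Module.End K V) (l : Filter ι) : Submodule K V where
  carrier := {v | ∀ᶠ k in l, T k v = 0}
  add_mem' hv hw := by
    filter_upwards [hv, hw] with k hkv hkw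
    rw [map_add, hkv, hkw, add_zero]
  zero_mem' := .of_forall fun _ => map_zero _
  smul_mem' c v hv := by
    filter_upwards [hv] with k hk
    rw [map_smul, hk, smul_zero]

/-- A sequence of operators is locally finite if each vector is annihilated by all but finitely
many of them; the sums `∑_k c_k T_k` then make sense. -/
def IsLocallyFinite (T : ℕ → Module.End K V) : Prop := ∀ v, v ∈ eventualKer T atTop

namespace IsLocallyFinite

variable {T W : ℕ → Module.End K V} (hT : IsLocallyFinite T)
include hT

theorem hasFiniteSupport_smul (c : ℕ → K) (v : V) :
    (fun k => c k • T k v).HasFiniteSupport := by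
  have finite_ne : {k | ¬ T k v = 0}.Finite := eventually_cofinite.1 <| by
    rw [Nat.cofinite_eq_atTop]
    exact hT v
  exact finite_ne.subset fun k hk h => hk (by simp only [h, smul_zero])

/-- The operator `∑_k c_k T_k` of a locally finite sequence, as a linear function of `c`. -/
noncomputable def sum : (ℕ → K) →ₗ[K] Module.End K V :=
  LinearMap.mk₂ K (fun c v => ∑ᶠ k, c k • T k v)
    (fun c c' v => by
      simp only [Pi.add_apply, add_smul]
      exact finsum_add_distrib (hT.hasFiniteSupport_smul c v) (hT.hasFiniteSupport_smul c' v))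
    (fun a c v => by simp only [Pi.smul_apply, smul_finsum, smul_assoc])
    (fun c v w => by
      simp only [map_add, smul_add]
      exact finsum_add_distrib (hT.hasFiniteSupport_smul c v) (hT.hasFiniteSupport_smul c w))
    (fun a c v => by simp only [map_smul, smul_finsum, smul_comm _ a])

theorem sum_apply (c : ℕ → K) (v : V) : hT.sum c v = ∑ᶠ k, c k • T k v := rfl

theorem sum_apply_eq {R : ℕ} {v : V} (hR : ∀ k, R ≤ k → T k v = 0) (c : ℕ → K) :
    hT.sum c v = ∑ k ∈ range R, c k • T k v := by
  refine finsum_eq_sum_of_support_subset _ fun k hk => ?_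
  by_contra hkR
  exact hk (by simp only [hR k (by simpa using hkR), smul_zero])

theorem eventually_sum_apply_eq (c : ℕ → K) (v : V) :
    ∀ᶠ R in atTop, hT.sum c v = ∑ k ∈ range R, c k • T k v := by
  filter_upwards [eventually_forall_ge_atTop.2 (hT v)] with R hR
  exact hT.sum_apply_eq hR c

theorem sum_mul_of_mul (hW : IsLocallyFinite W) {U : Module.End K V}
    (h : ∀ k, T k * U = U * T k + W k) (c : ℕ → K) :
    hT.sum c * U = U * hT.sum c + hW.sum c := by
  refine LinearMap.ext fun v => ?_
  obtain ⟨R, hRU, hRv, hRW⟩ := ((hT.eventually_sum_apply_eq c (U v)).and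
    ((hT.eventually_sum_apply_eq c v).and (hW.eventually_sum_apply_eq c v))).exists
  have h k : T k (U v) = U (T k v) + W k v := LinearMap.congr_fun (h k) v
  rw [Module.End.mul_apply, LinearMap.add_apply, Module.End.mul_apply, hRU, hRv, hRW]
  simp only [h, smul_add, sum_add_distrib, map_sum, map_smul]

theorem commute_sum {U : Module.End K V} (h : ∀ k, Commute (T k) U) (c : ℕ → K) :
    Commute (hT.sum c) U := by
  have hzero : IsLocallyFinite (0 : ℕ → Module.End K V) := fun _ => .of_forall fun _ => rfl
  have sum_zero : hzero.sum c = 0 := LinearMap.ext fun v => by simp [sum_apply]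
  have := hT.sum_mul_of_mul hzero (U := U) (fun k => by simpa using (h k).eq) c
  rwa [sum_zero, add_zero] at this

end IsLocallyFinite

/-- Every vector is annihilated by a power of the operator. -/
def IsLocallyNilpotent (A : Module.End K V) : Prop := IsLocallyFinite fun r => A ^ r

theorem mem_eventualKer_pow {A : Module.End K V} {v : V} {R : ℕ} (h : (A ^ R) v = 0) :
    v ∈ eventualKer (fun r : ℕ => A ^ r) atTop :=
  eventually_atTop.2 ⟨R, fun _ hr => Module.End.pow_map_zero_of_le hr h⟩

theorem sum_range_antidiagonal_eq {M : Type*} [AddCommMonoid M] {x : ℕ → ℕ → M} {R S : ℕ}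
    (hx : ∀ i j, R ≤ i ∨ S ≤ j → x i j = 0) :
    ∑ r ∈ range (R + S), ∑ ij ∈ antidiagonal r, x ij.1 ij.2 =
      ∑ i ∈ range R, ∑ j ∈ range S, x i j := by
  rw [← sum_product', ← sum_fiberwise_of_maps_to (g := fun ij : ℕ × ℕ => ij.1 + ij.2)
    (t := range (R + S)) fun ij hij => by simp only [mem_product, mem_range] at hij ⊢; omega]
  refine sum_congr rfl fun r _ => (sum_subset (fun ij hij => ?_) fun ij hr hij => ?_).symm
  · exact HasAntidiagonal.mem_antidiagonal.2 (mem_filter.1 hij).2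
  · refine hx _ _ ?_
    simp only [HasAntidiagonal.mem_antidiagonal, mem_filter, mem_product, mem_range] at hr hij
    omega

theorem inv_factorial_smul_choose_nsmul [CharZero K] (ij : ℕ × ℕ) (v : V) :
    ((ij.1 + ij.2).factorial : K)⁻¹ • (ij.1 + ij.2).choose ij.1 • v =
      (ij.1.factorial : K)⁻¹ • (ij.2.factorial : K)⁻¹ • v := by
  have := (ij.1 + ij.2).factorial_ne_zero
  have := ij.1.factorial_ne_zero
  have := ij.2.factorial_ne_zero
  rw [← Nat.cast_smul_eq_nsmul K, smul_smul, smul_smul, Nat.cast_add_choose]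
  congr 1
  field_simp

theorem sum_choose_nsmul_eq_zero {M : Type*} [AddCommMonoid M] {x : ℕ → ℕ → M} {R S : ℕ}
    (hx : ∀ i j, R ≤ i ∨ S ≤ j → x i j = 0) {r : ℕ} (hr : R + S ≤ r) :
    ∑ ij ∈ antidiagonal r, r.choose ij.1 • x ij.1 ij.2 = 0 := by
  refine sum_eq_zero fun ij hij => ?_
  rw [HasAntidiagonal.mem_antidiagonal] at hij
  rw [hx _ _ (by omega), smul_zero]

theorem exists_apply_pow_apply_eq_zero {B : Module.End K V} {T : ℕ → Module.End K V}
    (hT : IsLocallyFinite T) {v : V} (hv : v ∈ eventualKer (fun r : ℕ => B ^ r) atTop) :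
    ∃ R S, (∀ j, S ≤ j → (B ^ j) v = 0) ∧
      ∀ i j, R ≤ i ∨ S ≤ j → T i ((B ^ j) v) = 0 := by
  obtain ⟨S, hS⟩ := eventually_atTop.1 hv
  have eventually_lt : ∀ᶠ R in atTop, ∀ j < S, T R ((B ^ j) v) = 0 :=
    (Set.finite_lt_nat S).eventually_all.2 fun j _ => hT _
  obtain ⟨R, hR⟩ := eventually_atTop.1 eventually_lt
  refine ⟨R, S, hS, fun i j h => ?_⟩
  by_cases hj : j < S
  · exact hR i (by omega) j hj
  · rw [hS j (by omega), map_zero]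

theorem mem_eventualKer_pow_of_leibniz {A B : Module.End K V} {T : ℕ → Module.End K V}
    (hT : IsLocallyFinite T) {u v : V} (hv : v ∈ eventualKer (fun r : ℕ => B ^ r) atTop)
    (h : ∀ r, (A ^ r) u =
      ∑ ij ∈ antidiagonal r, r.choose ij.1 • T ij.1 ((B ^ ij.2) v)) :
    u ∈ eventualKer (fun r : ℕ => A ^ r) atTop := by
  obtain ⟨R, S, -, hRS⟩ := exists_apply_pow_apply_eq_zero hT hv
  exact mem_eventualKer_pow ((h (R + S)).trans (sum_choose_nsmul_eq_zero hRS le_rfl))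

namespace IsLocallyNilpotent

variable {A B : Module.End K V}

/-- The exponential of a locally nilpotent operator. -/
noncomputable def exp (hA : IsLocallyNilpotent A) : Module.End K V :=
  IsLocallyFinite.sum hA fun r => (r.factorial : K)⁻¹

theorem exp_apply_of_apply_eq_zero (hA : IsLocallyNilpotent A) {v : V} (hv : A v = 0) :
    hA.exp v = v := by
  have pow_apply_eq_zero (r : ℕ) (hr : 1 ≤ r) : (A ^ r) v = 0 :=
    Module.End.pow_map_zero_of_le hr (by simpa using hv)
  rw [exp, IsLocallyFinite.sum_apply_eq hA pow_apply_eq_zero]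
  simp

theorem exp_apply_of_leibniz [CharZero K] (hA : IsLocallyNilpotent A) (hB : IsLocallyNilpotent B)
    {T : ℕ → Module.End K V} (hT : IsLocallyFinite T) {u v : V}
    (h : ∀ r, (A ^ r) u =
      ∑ ij ∈ antidiagonal r, r.choose ij.1 • T ij.1 ((B ^ ij.2) v)) :
    hA.exp u = hT.sum (fun r => (r.factorial : K)⁻¹) (hB.exp v) := by
  obtain ⟨R, S, hS, hRS⟩ := exists_apply_pow_apply_eq_zero hT (hB v)
  have exp_v : hB.exp v = ∑ j ∈ range S, (j.factorial : K)⁻¹ • (B ^ j) v :=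
    IsLocallyFinite.sum_apply_eq hB hS _
  have T_exp_v (i : ℕ) (hi : R ≤ i) : T i (hB.exp v) = 0 := by
    simp only [exp_v, map_sum, map_smul, hRS i _ (.inl hi), smul_zero, sum_const_zero]
  have exp_u : hA.exp u = ∑ r ∈ range (R + S), (r.factorial : K)⁻¹ • (A ^ r) u :=
    IsLocallyFinite.sum_apply_eq hA
      (fun r hr => (h r).trans (sum_choose_nsmul_eq_zero hRS hr)) _
  rw [exp_u, hT.sum_apply_eq T_exp_v, exp_v]
  simp only [h, map_sum, map_smul, smul_sum]
  rw [← sum_range_antidiagonal_eq fun i j hij => by rw [hRS i j hij, smul_zero, smul_zero]]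
  refine sum_congr rfl fun r _ => sum_congr rfl fun ij hij => ?_
  rw [← HasAntidiagonal.mem_antidiagonal.1 hij, inv_factorial_smul_choose_nsmul]

theorem exp_add_of_commute [CharZero K] (hA : IsLocallyNilpotent A) (hB : IsLocallyNilpotent B)
    (hAB : IsLocallyNilpotent (A + B)) (h : Commute A B) :
    hAB.exp = hA.exp * hB.exp :=
  LinearMap.ext fun v => hAB.exp_apply_of_leibniz hB hA fun r => by
    simp [h.add_pow', LinearMap.sum_apply]

end IsLocallyNilpotent

end LocallyFinite

/-! ## Hamiltonians -/

/-- The series `∑_{k ≥ 1} s_k X^k` of the coefficients of the Hamiltonian `∑_{k ≥ 1} s_k J_k`; it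
does not involve `s 0`. -/
noncomputable def hamiltonianSeries {K : Type*} [Field K] (s : ℕ → K) : PowerSeries K :=
  PowerSeries.X * PowerSeries.mk fun k => s (k + 1)

theorem X_dvd_hamiltonianSeries {K : Type*} [Field K] (s : ℕ → K) :
    PowerSeries.X ∣ hamiltonianSeries s :=
  Dvd.intro _ rfl

namespace MetaplecticData

open Filter

variable {n : ℕ} {K : Type*} [Field K] (F : MetaplecticData n K)

theorem eventually_wedge_eq_zero (v : FockSpace K) : v ∈ eventualKer F.wedge atBot := by
  refine F.mem_of_wedge (fun w hw => ?_) (fun m v hv ih => ?_) v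
  · filter_upwards [eventually_le_atBot (w.m 0)] with j hj
    exact F.wedge_vacuum hw hj
  · obtain ⟨B, hB⟩ := eventually_atBot.1 ih
    filter_upwards [eventually_lt_atBot m, eventually_le_atBot (2 * B - m)] with j hjm hjB
    rw [F.wedge_wedge_of_mem hjm hv, ← Submodule.mem_bot K]
    refine F.normalOrder_mem hjm _ fun a b _ hba _ hab => ?_
    rw [hB b (by omega), map_zero]
    exact Submodule.zero_mem _

variable [NeZero n]

theorem isLocallyFinite_wedge (m : ℤ) : IsLocallyFinite fun k : ℕ => F.wedge (m - k * n) := by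
  intro v
  refine Tendsto.eventually (l₂ := atBot) ?_ (F.eventually_wedge_eq_zero v)
  refine tendsto_atBot.2 fun b => ?_
  filter_upwards [eventually_ge_atTop (m - b).toNat] with k hk
  have : (k : ℤ) ≤ k * n :=
    le_mul_of_one_le_right (Int.natCast_nonneg k) (by exact_mod_cast NeZero.one_le)
  omega

theorem isLocallyFinite_current : IsLocallyFinite fun k : ℕ => F.current ((k : ℤ) + 1) := by
  refine F.mem_of_wedge (fun w hw => .of_forall fun k => F.current_vacuum (by omega) hw)
    fun m v hv ih => ?_
  filter_upwards [ih, (tendsto_add_atTop_nat 1).eventually (F.isLocallyFinite_wedge m v)]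
    with k current_eq wedge_eq
  rw [F.current_wedge_of_mem (by omega) hv, current_eq, map_zero, add_zero]
  exact_mod_cast wedge_eq

theorem hamiltonian_eq_sum_current (s : ℕ → K) :
    F.hamiltonian s = F.isLocallyFinite_current.sum fun k => s (k + 1) :=
  Finsupp.lhom_ext' fun w => LinearMap.ext_ring (by simp [hamiltonian, IsLocallyFinite.sum_apply])

theorem hamiltonian_add (s s' : ℕ → K) :
    F.hamiltonian (s + s') = F.hamiltonian s + F.hamiltonian s' := by
  simp only [hamiltonian_eq_sum_current, ← map_add]
  rfl

theorem hamiltonian_zero : F.hamiltonian (0 : ℕ → K) = 0 := by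
  rw [hamiltonian_eq_sum_current]
  exact map_zero _

theorem hamiltonian_vacuum (s : ℕ → K) {w : NormalWedge} (hw : w.IsVacuum) :
    F.hamiltonian s (Finsupp.single w 1) = 0 := by
  rw [hamiltonian_eq_sum_current,
    IsLocallyFinite.sum_apply_eq _ (R := 0) fun k _ => F.current_vacuum (by omega) hw]
  exact Finset.sum_range_zero _

theorem commute_hamiltonian [CharZero K] (s s' : ℕ → K) :
    Commute (F.hamiltonian s) (F.hamiltonian s') := by
  rw [hamiltonian_eq_sum_current, hamiltonian_eq_sum_current]
  refine IsLocallyFinite.commute_sum _ (fun k => ?_) _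
  refine (IsLocallyFinite.commute_sum _ (fun l => ?_) _).symm
  exact_mod_cast F.current_comm l.succ_pos k.succ_pos

/-- The operator `∑_k p_k u_{m - k n} ∧ ·` of a power series `p = ∑_k p_k X^k`. -/
noncomputable def seriesWedge (m : ℤ) : PowerSeries K →ₗ[K] Module.End K (FockSpace K) :=
  (F.isLocallyFinite_wedge m).sum ∘ₗ LinearMap.pi fun k => PowerSeries.coeff k

theorem seriesWedge_eq_sum {m : ℤ} {v : FockSpace K} {R : ℕ}
    (hR : ∀ k : ℕ, R ≤ k → F.wedge (m - k * n) v = 0) (p : PowerSeries K) :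
    F.seriesWedge m p v =
      ∑ k ∈ Finset.range R, PowerSeries.coeff k p • F.wedge (m - k * n) v :=
  (F.isLocallyFinite_wedge m).sum_apply_eq hR _

theorem seriesWedge_one (m : ℤ) : F.seriesWedge m 1 = F.wedge m := by
  refine LinearMap.ext fun v => ?_
  refine (finsum_eq_single _ 0 fun k hk => ?_).trans ?_
  · simp [PowerSeries.coeff_one, hk]
  · simp

theorem seriesWedge_X_mul (m : ℤ) (p : PowerSeries K) :
    F.seriesWedge m (PowerSeries.X * p) = F.seriesWedge (m - n) p := by
  refine LinearMap.ext fun v => ?_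
  refine (finsum_eq_zero_add ((F.isLocallyFinite_wedge m).hasFiniteSupport_smul _ v)).trans ?_
  simp only [LinearMap.pi_apply, PowerSeries.coeff_zero_X_mul, zero_smul, zero_add,
    PowerSeries.coeff_succ_X_mul]
  refine finsum_congr fun k => ?_
  rw [LinearMap.pi_apply, show m - (k + 1 : ℕ) * n = m - n - k * n by push_cast; ring]

theorem seriesWedge_X_pow_mul (m : ℤ) (k : ℕ) (p : PowerSeries K) :
    F.seriesWedge m (PowerSeries.X ^ k * p) = F.seriesWedge (m - k * n) p := by
  induction k generalizing m with
  | zero => simp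
  | succ k ih =>
    rw [pow_succ', mul_assoc, seriesWedge_X_mul, ih]
    congr 2
    push_cast
    ring

theorem seriesWedge_apply_congr {m : ℤ} {v : FockSpace K} {R : ℕ}
    (hR : ∀ k : ℕ, R ≤ k → F.wedge (m - k * n) v = 0) {p p' : PowerSeries K}
    (h : PowerSeries.X ^ R ∣ p - p') : F.seriesWedge m p v = F.seriesWedge m p' v := by
  rw [F.seriesWedge_eq_sum hR, F.seriesWedge_eq_sum hR]
  refine Finset.sum_congr rfl fun k hk => ?_
  have coeff_sub := PowerSeries.X_pow_dvd_iff.1 h k (Finset.mem_range.1 hk)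
  rw [map_sub, sub_eq_zero] at coeff_sub
  rw [coeff_sub]

theorem seriesWedge_mul_apply {m : ℤ} {v : FockSpace K} {R : ℕ}
    (hR : ∀ k : ℕ, R ≤ k → F.wedge (m - k * n) v = 0) (p p' : PowerSeries K) :
    F.seriesWedge m (p * p') v =
      ∑ k ∈ Finset.range R, PowerSeries.coeff k p • F.seriesWedge (m - k * n) p' v := by
  have dvd_sub : PowerSeries.X ^ R ∣
      p * p' - (∑ k ∈ Finset.range R, PowerSeries.coeff k p • PowerSeries.X ^ k) * p' := by
    rw [← sub_mul]
    refine Dvd.dvd.mul_right (PowerSeries.X_pow_dvd_iff.2 fun k hk => ?_) _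
    simp [PowerSeries.coeff_X_pow, hk]
  rw [F.seriesWedge_apply_congr hR dvd_sub]
  simp [Finset.sum_mul, LinearMap.sum_apply, seriesWedge_X_pow_mul]

variable [CharZero K]

theorem hamiltonian_wedge (s : ℕ → K) (m : ℤ) (v : FockSpace K) :
    F.hamiltonian s (F.wedge m v) =
      F.wedge m (F.hamiltonian s v) + F.seriesWedge m (hamiltonianSeries s) v := by
  have current_mul_wedge (k : ℕ) : F.current ((k : ℤ) + 1) * F.wedge m =
      F.wedge m * F.current ((k : ℤ) + 1) + F.wedge (m - n - k * n) := by
    refine LinearMap.ext fun v => ?_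
    have := F.current_wedge k.succ_pos m v
    push_cast at this
    rw [Module.End.mul_apply, this, add_comm, sub_sub, add_one_mul, add_comm (k * n : ℤ)]
    rfl
  have := IsLocallyFinite.sum_mul_of_mul F.isLocallyFinite_current
    (F.isLocallyFinite_wedge (m - n)) current_mul_wedge fun k => s (k + 1)
  rw [hamiltonian_eq_sum_current, hamiltonianSeries, seriesWedge_X_mul]
  refine (LinearMap.congr_fun this v).trans (congrArg (F.wedge m _ + ·) ?_)
  simp only [seriesWedge, LinearMap.comp_apply]
  congr 2
  exact funext fun k => (PowerSeries.coeff_mk k fun k => s (k + 1)).symm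

theorem hamiltonian_seriesWedge (s : ℕ → K) (m : ℤ) (p : PowerSeries K) (v : FockSpace K) :
    F.hamiltonian s (F.seriesWedge m p v) =
      F.seriesWedge m p (F.hamiltonian s v) + F.seriesWedge m (p * hamiltonianSeries s) v := by
  obtain ⟨R, hR, hR'⟩ := ((eventually_forall_ge_atTop.2 (F.isLocallyFinite_wedge m v)).and
    (eventually_forall_ge_atTop.2 (F.isLocallyFinite_wedge m (F.hamiltonian s v)))).exists
  rw [F.seriesWedge_eq_sum hR, F.seriesWedge_eq_sum hR', F.seriesWedge_mul_apply hR,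
    ← Finset.sum_add_distrib, map_sum]
  refine Finset.sum_congr rfl fun k _ => ?_
  rw [map_smul, hamiltonian_wedge, smul_add]

theorem hamiltonian_pow_wedge (s : ℕ → K) (m : ℤ) (v : FockSpace K) (r : ℕ) :
    (F.hamiltonian s ^ r) (F.wedge m v) =
      ∑ ij ∈ Finset.HasAntidiagonal.antidiagonal r, r.choose ij.1 •
        F.seriesWedge m (hamiltonianSeries s ^ ij.1) ((F.hamiltonian s ^ ij.2) v) := by
  induction r with
  | zero => simp [seriesWedge_one]
  | succ r ih =>
    rw [Finset.sum_antidiagonal_choose_succ_nsmul (fun i j =>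
        F.seriesWedge m (hamiltonianSeries s ^ i) ((F.hamiltonian s ^ j) v)) r, pow_succ',
      Module.End.mul_apply, ih, map_sum, ← Finset.sum_add_distrib]
    refine Finset.sum_congr rfl fun ij hij => ?_
    have choose_symm : r.choose ij.2 = r.choose ij.1 := by
      rw [← Finset.HasAntidiagonal.mem_antidiagonal.1 hij, Nat.choose_symm_add]
    rw [map_nsmul, hamiltonian_seriesWedge, nsmul_add, choose_symm, ← pow_succ,
      pow_succ' (F.hamiltonian s) ij.2, Module.End.mul_apply]

end MetaplecticData

/-! ## Exponentials of Hamiltonians -/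

section PowerSeries

open PowerSeries

variable {K : Type*} [Field K]

theorem derivative_hamiltonianSeries (s : ℕ → K) :
    derivative K (hamiltonianSeries s) = mk fun k => (k + 1) * s (k + 1) := by
  ext k
  rw [coeff_derivative, hamiltonianSeries, coeff_succ_X_mul, coeff_mk, coeff_mk, mul_comm]

theorem mk_pow_succ_mul_one_sub (θ : K) :
    (mk fun k => θ ^ (k + 1)) * (1 - C θ * X) = C θ := by
  ext k
  rw [mul_sub, mul_one, mul_left_comm, map_sub, coeff_C_mul]
  cases k with
  | zero => simp
  | succ k => simp [coeff_succ_mul_X, pow_succ' θ (k + 1)]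

variable [CharZero K]

theorem eq_of_derivative_mul_eq {u v : PowerSeries K}
    (h : derivative K u * v = u * derivative K v)
    (constantCoeff_eq : constantCoeff u = constantCoeff v) (hv : constantCoeff v ≠ 0) :
    u = v := by
  have v_mul_inv : v * v⁻¹ = 1 := PowerSeries.mul_inv_cancel v hv
  have quotient_eq_one : u * v⁻¹ = 1 := by
    apply derivative.ext
    · rw [derivative_one, Derivation.leibniz, derivative_inv', smul_eq_mul, smul_eq_mul]
      linear_combination (v⁻¹) ^ 2 * h - v⁻¹ * derivative K u * v_mul_inv
    · simp [constantCoeff_eq, hv]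
  rw [← mul_one u, ← v_mul_inv, mul_left_comm, quotient_eq_one, mul_one]

theorem exp_subst_powerSum_mul (θ π : K) :
    (exp K).subst (hamiltonianSeries fun k => θ ^ k / k - π ^ k / k) * (1 - C θ * X) =
      1 - C π * X := by
  set σ : PowerSeries K := hamiltonianSeries fun k => θ ^ k / k - π ^ k / k with hσ
  have hsub : HasSubst σ :=
    HasSubst.of_constantCoeff_zero' (X_dvd_iff.1 (X_dvd_hamiltonianSeries _))
  have derivative_σ :
      derivative K σ = (mk fun k => θ ^ (k + 1)) - mk fun k => π ^ (k + 1) := by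
    rw [hσ, derivative_hamiltonianSeries]
    ext k
    have : (k : K) + 1 ≠ 0 := Nat.cast_add_one_ne_zero k
    simp only [coeff_mk, map_sub]
    push_cast
    field_simp
  have derivative_exp_subst :
      derivative K ((exp K).subst σ) = (exp K).subst σ * derivative K σ := by
    rw [derivative_subst hsub, derivative_exp]
  have derivative_linear (a : K) : derivative K (1 - C a * X : PowerSeries K) = -C a := by
    simp
  refine eq_of_derivative_mul_eq ?_ ?_ (by simp)
  · rw [Derivation.leibniz, derivative_linear, derivative_linear, derivative_exp_subst,
      derivative_σ, smul_eq_mul, smul_eq_mul]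
    linear_combination (exp K).subst σ * ((1 - C π * X) * mk_pow_succ_mul_one_sub θ -
      (1 - C θ * X) * mk_pow_succ_mul_one_sub π)
  · have constantCoeff_exp_subst : constantCoeff ((exp K).subst σ) = 1 := by
      rw [← coeff_zero_eq_constantCoeff_apply, coeff_subst' hsub, finsum_eq_single _ 0]
      · simp
      · intro i hi
        simp [X_dvd_iff.1 (X_dvd_hamiltonianSeries _), hσ, hi]
    simp [constantCoeff_exp_subst]

end PowerSeries

namespace MetaplecticData

open Filter

variable {n : ℕ} {K : Type*} [Field K] (F : MetaplecticData n K) [NeZero n]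

theorem isLocallyFinite_seriesWedge_pow (m : ℤ) {σ : PowerSeries K} (hσ : PowerSeries.X ∣ σ) :
    IsLocallyFinite fun i => F.seriesWedge m (σ ^ i) := by
  intro v
  filter_upwards [eventually_forall_ge_atTop.2 (F.isLocallyFinite_wedge m v)] with R hR
  rw [F.seriesWedge_apply_congr hR (p' := 0) (by simpa using pow_dvd_pow_of_dvd hσ R), map_zero,
    LinearMap.zero_apply]

theorem sum_coeff_seriesWedge_pow (m : ℤ) {σ : PowerSeries K} (hσ : PowerSeries.X ∣ σ)
    (p : PowerSeries K) :
    (F.isLocallyFinite_seriesWedge_pow m hσ).sum (fun i => PowerSeries.coeff i p) =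
      F.seriesWedge m (p.subst σ) := by
  refine LinearMap.ext fun v => ?_
  obtain ⟨R, hR, sum_eq⟩ := ((eventually_forall_ge_atTop.2 (F.isLocallyFinite_wedge m v)).and
    (IsLocallyFinite.eventually_sum_apply_eq (F.isLocallyFinite_seriesWedge_pow m hσ)
      (fun i => PowerSeries.coeff i p) v)).exists
  have hsub : PowerSeries.HasSubst σ :=
    PowerSeries.HasSubst.of_constantCoeff_zero' (PowerSeries.X_dvd_iff.1 hσ)
  have dvd_sub : PowerSeries.X ^ R ∣
      p.subst σ - ∑ i ∈ Finset.range R, PowerSeries.coeff i p • σ ^ i := by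
    refine PowerSeries.X_pow_dvd_iff.2 fun k hk => ?_
    rw [map_sub, PowerSeries.coeff_subst' hsub,
      finsum_eq_sum_of_support_subset (s := Finset.range R), sub_eq_zero]
    · simp
    · intro i hi
      by_contra hiR
      have : k < i := by simp at hiR; omega
      exact hi (by simp [PowerSeries.X_pow_dvd_iff.1 (pow_dvd_pow_of_dvd hσ i) k this])
  rw [sum_eq, F.seriesWedge_apply_congr hR dvd_sub]
  simp [LinearMap.sum_apply]

variable [CharZero K]

theorem isLocallyNilpotent_hamiltonian (s : ℕ → K) : IsLocallyNilpotent (F.hamiltonian s) :=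
  F.mem_of_wedge
    (fun w hw => mem_eventualKer_pow (R := 1) (by simpa using F.hamiltonian_vacuum s hw))
    fun m v _ ih => mem_eventualKer_pow_of_leibniz
      (F.isLocallyFinite_seriesWedge_pow m (X_dvd_hamiltonianSeries s)) ih
      (F.hamiltonian_pow_wedge s m v)

/-- The operator `e^H` for the Hamiltonian `H = ∑_{k ≥ 1} s_k J_k`. -/
noncomputable def hamiltonianExp (s : ℕ → K) : Module.End K (FockSpace K) :=
  (F.isLocallyNilpotent_hamiltonian s).exp

theorem hamiltonianExp_single (s : ℕ → K) (w : NormalWedge) :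
    F.hamiltonianExp s (Finsupp.single w 1) = F.expHamiltonian s w := rfl

theorem hamiltonianExp_vacuum (s : ℕ → K) {w : NormalWedge} (hw : w.IsVacuum) :
    F.hamiltonianExp s (Finsupp.single w 1) = Finsupp.single w 1 :=
  IsLocallyNilpotent.exp_apply_of_apply_eq_zero _ (F.hamiltonian_vacuum s hw)

theorem hamiltonianExp_zero : F.hamiltonianExp 0 = 1 :=
  LinearMap.ext fun v => IsLocallyNilpotent.exp_apply_of_apply_eq_zero _ (by
    rw [hamiltonian_zero, LinearMap.zero_apply])

theorem hamiltonianExp_add (s s' : ℕ → K) :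
    F.hamiltonianExp (s + s') = F.hamiltonianExp s * F.hamiltonianExp s' := by
  have hadd := F.isLocallyNilpotent_hamiltonian (s + s')
  rw [hamiltonian_add] at hadd
  refine Eq.trans ?_ (IsLocallyNilpotent.exp_add_of_commute _ _ hadd (F.commute_hamiltonian s s'))
  simp only [hamiltonianExp, hamiltonian_add]

theorem hamiltonianExp_wedge (s : ℕ → K) (m : ℤ) (v : FockSpace K) :
    F.hamiltonianExp s (F.wedge m v) =
      F.seriesWedge m ((PowerSeries.exp K).subst (hamiltonianSeries s))
        (F.hamiltonianExp s v) := by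
  have := IsLocallyNilpotent.exp_apply_of_leibniz (F.isLocallyNilpotent_hamiltonian s)
    (F.isLocallyNilpotent_hamiltonian s)
    (F.isLocallyFinite_seriesWedge_pow m (X_dvd_hamiltonianSeries s))
    (F.hamiltonian_pow_wedge s m v)
  rw [← F.sum_coeff_seriesWedge_pow m (X_dvd_hamiltonianSeries s)]
  refine this.trans ?_
  simp only [PowerSeries.coeff_exp, one_div, map_inv₀, map_natCast, hamiltonianExp]

theorem hamiltonianExp_wedge_sub (θ π : K) (m : ℤ) (v : FockSpace K) :
    F.hamiltonianExp (fun k => θ ^ k / k - π ^ k / k)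
        (F.wedge m v - θ • F.wedge (m - n) v) =
      F.wedge m (F.hamiltonianExp (fun k => θ ^ k / k - π ^ k / k) v) -
        π • F.wedge (m - n) (F.hamiltonianExp (fun k => θ ^ k / k - π ^ k / k) v) := by
  have seriesWedge_sub (p : PowerSeries K) (a : K) (u : FockSpace K) :
      F.seriesWedge m p u - a • F.seriesWedge (m - n) p u =
        F.seriesWedge m (p * (1 - PowerSeries.C a * PowerSeries.X)) u := by
    have mul_eq : p * (1 - PowerSeries.C a * PowerSeries.X) = p - a • (PowerSeries.X * p) := by
      rw [PowerSeries.smul_eq_C_mul]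
      ring
    rw [mul_eq, map_sub, map_smul, seriesWedge_X_mul, LinearMap.sub_apply, LinearMap.smul_apply]
  rw [map_sub, map_smul, hamiltonianExp_wedge, hamiltonianExp_wedge, seriesWedge_sub,
    exp_subst_powerSum_mul, ← one_mul (1 - _ : PowerSeries K), ← seriesWedge_sub, seriesWedge_one,
    seriesWedge_one]

end MetaplecticData

/-! ## Wedges of boundary spins -/

namespace NormalWedge

/-- The wedge `u_{-1} ∧ u_{-2} ∧ ⋯`. -/
def vac : NormalWedge := ofStrict (Fin.elim0 : Fin 0 → ℕ) fun i => i.elim0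

theorem vac_m (i : ℕ) : vac.m i = -1 - i := by
  simp [vac, ofStrict]

theorem isVacuum_vac : vac.IsVacuum := fun i => by
  rw [vac_m, vac_m]
  push_cast
  ring

theorem ext_range {w w' : NormalWedge} (h : Set.range w.m = Set.range w'.m) : w = w' := by
  have strictMono (w : NormalWedge) : StrictMono fun i => OrderDual.toDual (w.m i) :=
    fun _ _ hij => w.strictAnti hij
  exact NormalWedge.ext (((strictMono w).range_inj (strictMono w')).1 h)

theorem mem_range_ofStrict {ℓ : ℕ} {κ : Fin ℓ → ℕ} (hκ : StrictAnti κ) {j : ℤ} :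
    j ∈ Set.range (ofStrict κ hκ).m ↔ j < 0 ∨ ∃ i, (κ i : ℤ) = j := by
  constructor
  · rintro ⟨i, rfl⟩
    by_cases h : i < ℓ
    · exact .inr ⟨⟨i, h⟩, by simp [ofStrict, h]⟩
    · refine .inl ?_
      simp only [ofStrict, h, dif_neg, not_false_eq_true]
      omega
  · rintro (hj | ⟨i, rfl⟩)
    · have h : ¬ (ℓ - 1 - j).toNat < ℓ := by omega
      refine ⟨(ℓ - 1 - j).toNat, ?_⟩
      simp only [ofStrict, h, dif_neg, not_false_eq_true]
      omega
    · exact ⟨i, by simp [ofStrict]⟩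

theorem range_cons {w : NormalWedge} {j : ℤ} (hj : w.m 0 < j) :
    Set.range (w.cons j hj).m = insert j (Set.range w.m) := by
  ext k
  constructor
  · rintro ⟨_ | i, rfl⟩
    exacts [.inl rfl, .inr ⟨i, rfl⟩]
  · rintro (rfl | ⟨i, rfl⟩)
    exacts [⟨0, rfl⟩, ⟨i + 1, rfl⟩]

end NormalWedge

/-- The number of spins `-`. -/
def countSpins {c : ℕ} (β : Fin c → Bool) : ℕ := ∑ j, (β j).toNat

theorem countSpins_succ {c : ℕ} (β : Fin (c + 1) → Bool) :
    countSpins β = countSpins (fun j => β j.castSucc) + (β (Fin.last c)).toNat :=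
  Fin.sum_univ_castSucc _

theorem countSpins_boundarySpins {ℓ M : ℕ} {κ : Fin ℓ → ℕ} (hκ : StrictAnti κ)
    (hM : ∀ i, κ i ≤ M) : countSpins (boundarySpins M κ) = ℓ := by
  let part (i : Fin ℓ) : Fin (M + 1) := ⟨κ i, Nat.lt_succ_of_le (hM i)⟩
  have part_injective : Function.Injective part := fun i j hij =>
    hκ.injective (by simpa [part] using hij)
  have boundarySpins_eq : boundarySpins M κ = fun c => decide (c ∈ Finset.univ.image part) := by
    ext c
    simp [boundarySpins, part, Fin.ext_iff]
  calc countSpins (boundarySpins M κ) = (Finset.univ.image part).card := by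
        simp [countSpins, boundarySpins_eq, Bool.toNat, Bool.cond_decide]
    _ = ℓ := by rw [Finset.card_image_of_injective _ part_injective, Finset.card_fin]

namespace MetaplecticData

variable {n : ℕ} {K : Type*} [Field K] (F : MetaplecticData n K)

/-- The factor contributed by a vertical spin in column `c`: wedging with `u_c` for the spin `-`,
and nothing for the spin `+`. -/
noncomputable def wedgeSpin (c : ℕ) (b : Bool) : Module.End K (FockSpace K) :=
  if b then F.wedge c else 1

/-- The wedge of the `u_j` over the columns `j < c` with spin `-`, followed by
`u_{-1} ∧ u_{-2} ∧ ⋯`. -/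
noncomputable def spinWedge : (c : ℕ) → (Fin c → Bool) → FockSpace K
  | 0, _ => Finsupp.single NormalWedge.vac 1
  | c + 1, β => F.wedgeSpin c (β (Fin.last c)) (spinWedge c fun j => β j.castSucc)

/-- The span of the wedges of boundary spins in the columns `0, …, c - 1`. -/
noncomputable def spinSpan (c : ℕ) : Submodule K (FockSpace K) :=
  Submodule.span K (Set.range (F.spinWedge c))

theorem spinWedge_mem_spinSpan (c : ℕ) (β : Fin c → Bool) : F.spinWedge c β ∈ F.spinSpan c :=
  Submodule.subset_span (Set.mem_range_self β)

theorem spinSpan_zero_le {S : Submodule K (FockSpace K)}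
    (h : Finsupp.single NormalWedge.vac 1 ∈ S) : F.spinSpan 0 ≤ S := by
  rw [spinSpan, Submodule.span_le]
  rintro _ ⟨β, rfl⟩
  exact h

theorem spinSpan_succ_le {c : ℕ} {S : Submodule K (FockSpace K)}
    (h : ∀ b, ∀ v ∈ F.spinSpan c, F.wedgeSpin c b v ∈ S) : F.spinSpan (c + 1) ≤ S := by
  rw [spinSpan, Submodule.span_le]
  rintro _ ⟨β, rfl⟩
  exact h _ _ (F.spinWedge_mem_spinSpan c _)

theorem eqOn_spinSpan_succ {E : Type*} [AddCommGroup E] [Module K E] {f g : FockSpace K →ₗ[K] E}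
    {c : ℕ} (off : ∀ v ∈ F.spinSpan c, f v = g v)
    (on : ∀ v ∈ F.spinSpan c, f (F.wedge c v) = g (F.wedge c v)) :
    ∀ v ∈ F.spinSpan (c + 1), f v = g v :=
  F.spinSpan_succ_le (S := LinearMap.eqLocus f g) fun
    | false => off
    | true => on

theorem wedgeSpin_mem_spinSpan (c : ℕ) (b : Bool) {v : FockSpace K} (hv : v ∈ F.spinSpan c) :
    F.wedgeSpin c b v ∈ F.spinSpan (c + 1) := by
  suffices F.spinSpan c ≤ (F.spinSpan (c + 1)).comap (F.wedgeSpin c b) from this hv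
  rw [spinSpan, Submodule.span_le]
  rintro _ ⟨β, rfl⟩
  have : F.spinWedge (c + 1) (Fin.snoc β b) = F.wedgeSpin c b (F.spinWedge c β) := by
    simp [spinWedge]
  rw [SetLike.mem_coe, Submodule.mem_comap, ← this]
  exact F.spinWedge_mem_spinSpan _ _

theorem spinSpan_le_succ (c : ℕ) : F.spinSpan c ≤ F.spinSpan (c + 1) :=
  fun _ => F.wedgeSpin_mem_spinSpan c false

theorem wedge_mem_spinSpan_succ {c : ℕ} {v : FockSpace K} (hv : v ∈ F.spinSpan c) :
    F.wedge c v ∈ F.spinSpan (c + 1) :=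
  F.wedgeSpin_mem_spinSpan c true hv

theorem exists_spinWedge_eq_single (c : ℕ) (β : Fin c → Bool) :
    ∃ w : NormalWedge, F.spinWedge c β = Finsupp.single w 1 ∧ w.m 0 < c ∧
      ∀ j : ℤ, j ∈ Set.range w.m ↔ j < 0 ∨ ∃ i, β i = true ∧ (i : ℤ) = j := by
  induction c with
  | zero =>
    refine ⟨NormalWedge.vac, rfl, by simp [NormalWedge.vac_m], fun j => ?_⟩
    exact (NormalWedge.mem_range_ofStrict fun i => i.elim0).trans (by simp)
  | succ c ih =>
    obtain ⟨w, spinWedge_eq, head_lt, mem_range⟩ := ih fun j => β j.castSucc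
    cases last : β (Fin.last c) with
    | true =>
      refine ⟨w.cons c head_lt, ?_,
        (by push_cast; exact lt_add_one _ : (c : ℤ) < (c + 1 : ℕ)), fun j => ?_⟩
      · rw [spinWedge, last, spinWedge_eq]
        exact F.wedge_single_of_lt head_lt
      · rw [NormalWedge.range_cons, Set.mem_insert_iff, mem_range]
        simp [Fin.exists_fin_succ', last]
        grind
    | false =>
      refine ⟨w, ?_, by push_cast; omega, fun j => ?_⟩
      · rw [spinWedge, last, spinWedge_eq]
        rfl
      · rw [mem_range]
        simp [Fin.exists_fin_succ', last]

theorem spinSpan_le_firstLT (c : ℕ) : F.spinSpan c ≤ firstLT K c := by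
  rw [spinSpan, Submodule.span_le]
  rintro _ ⟨β, rfl⟩
  obtain ⟨w, spinWedge_eq, head_lt, -⟩ := F.exists_spinWedge_eq_single c β
  rw [spinWedge_eq]
  exact single_mem_firstLT head_lt 1

theorem spinWedge_apply_ofStrict {ℓ M : ℕ} {κ : Fin ℓ → ℕ} (hκ : StrictAnti κ)
    (hM : ∀ i, κ i ≤ M) (β : Fin (M + 1) → Bool) :
    F.spinWedge (M + 1) β (NormalWedge.ofStrict κ hκ) =
      if β = boundarySpins M κ then 1 else 0 := by
  obtain ⟨w, spinWedge_eq, -, mem_range⟩ := F.exists_spinWedge_eq_single (M + 1) β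
  have : w = NormalWedge.ofStrict κ hκ ↔ β = boundarySpins M κ := by
    have parts_eq (j : ℤ) : (∃ i, boundarySpins M κ i = true ∧ (i : ℤ) = j) ↔
        ∃ i, (κ i : ℤ) = j := by
      simp only [boundarySpins, decide_eq_true_eq]
      constructor
      · rintro ⟨_, ⟨i, part_eq⟩, rfl⟩
        exact ⟨i, congrArg Nat.cast part_eq⟩
      · rintro ⟨i, rfl⟩
        exact ⟨⟨κ i, Nat.lt_succ_of_le (hM i)⟩, ⟨i, rfl⟩, rfl⟩
    constructor
    · rintro rfl
      ext j
      specialize mem_range j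
      rw [NormalWedge.mem_range_ofStrict] at mem_range
      rw [Bool.eq_iff_iff]
      simpa [boundarySpins, ← Fin.ext_iff, (Int.natCast_nonneg _).not_gt] using mem_range.symm
    · rintro rfl
      refine NormalWedge.ext_range (Set.ext fun j => ?_)
      rw [mem_range, NormalWedge.mem_range_ofStrict, parts_eq]
  classical rw [spinWedge_eq, Finsupp.single_apply]
  simp only [this]

theorem spinWedge_boundarySpins {ℓ M : ℕ} {κ : Fin ℓ → ℕ} (hκ : StrictAnti κ)
    (hM : ∀ i, κ i ≤ M) : F.spinWedge (M + 1) (boundarySpins M κ) =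
      Finsupp.single (NormalWedge.ofStrict κ hκ) 1 := by
  have apply_eq := F.spinWedge_apply_ofStrict hκ hM (boundarySpins M κ)
  obtain ⟨w, spinWedge_eq, -, -⟩ := F.exists_spinWedge_eq_single (M + 1) (boundarySpins M κ)
  classical rw [spinWedge_eq, Finsupp.single_apply] at apply_eq
  rw [spinWedge_eq]
  congr 1
  by_contra hne
  simp [hne] at apply_eq

theorem wedge_mem_spinSpan {c : ℕ} {j : ℤ} (hj : j < c) {v : FockSpace K}
    (hv : v ∈ F.spinSpan c) : F.wedge j v ∈ F.spinSpan c := by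
  suffices F.spinSpan c ≤ (F.spinSpan c).comap (F.wedge j) from this hv
  clear hv
  induction c generalizing j with
  | zero =>
    refine F.spinSpan_zero_le ?_
    rw [Submodule.mem_comap, F.wedge_vacuum NormalWedge.isVacuum_vac]
    · exact Submodule.zero_mem _
    · rw [NormalWedge.vac_m]
      push_cast at hj ⊢
      omega
  | succ c ih =>
    have wedge_mem {j : ℤ} (hj : j < (c + 1 : ℕ)) {v : FockSpace K} (hv : v ∈ F.spinSpan c) :
        F.wedge j v ∈ F.spinSpan (c + 1) := by
      push_cast at hj
      rcases (Int.lt_add_one_iff.1 hj).lt_or_eq with hjc | rfl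
      · exact F.spinSpan_le_succ c (ih hjc hv)
      · exact F.wedge_mem_spinSpan_succ hv
    refine F.spinSpan_succ_le fun b v hv => ?_
    cases b with
    | false => exact wedge_mem hj hv
    | true =>
      change F.wedge j (F.wedge c v) ∈ F.spinSpan (c + 1)
      have hv' := F.spinSpan_le_firstLT c hv
      push_cast at hj
      rcases (Int.lt_add_one_iff.1 hj).lt_or_eq with hjc | rfl
      · rw [F.wedge_wedge_of_mem hjc hv']
        exact F.normalOrder_mem hjc (F.spinSpan (c + 1)) fun a b _ _ _ _ =>
          wedge_mem (by push_cast; omega) (ih (by omega) hv)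
      · rw [F.wedge_wedge_self_of_mem hv']
        exact Submodule.zero_mem _

end MetaplecticData

/-! ## The row transfer operator -/

namespace MetaplecticData

variable {n : ℕ} {K : Type*} [Field K] (F : MetaplecticData n K) (x : ZMod n → K) (Q : K)

theorem natCast_ne_zero_of_lt {b : ℕ} (h0 : 0 < b) (h1 : b < n) : (b : ZMod n) ≠ 0 := by
  exact_mod_cast intCast_ne_zero_of_lt (n := n) (a := b) (by omega) (by omega)

/-- The weight for a horizontal path of charge `a` to cross a vertical path.  The parameter `Q`
stands for `q ^ 2`, but for `n = 1` it is not determined by the Fock space. -/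
def crossWeight (a : ZMod n) : K := x a * if a = 0 then -Q else F.g a

/-- The weights of a row normalised by `a₁ = b₁ = c₂ = 1`. -/
def rowWeights : BoltzmannWeights n K where
  a₁ := 1
  a₂ := F.crossWeight x Q
  b₁ := 1
  b₂ := x
  c₁ := (1 - Q) * x 0
  c₂ := 1

variable [NeZero n]

/-- One row of the normalised lattice model with columns `0, …, c - 1`, with the given spin on the
right boundary and `+` on the left boundary, as an operator from the bottom to the top boundary. -/
noncomputable def rowOp : ℕ → DecoratedSpin n → Module.End K (FockSpace K)
  | 0, r => if r = none then 1 else 0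
  | c + 1, r => Finsupp.linearCombination K fun w : NormalWedge =>
      ∑ l, ∑ b, (F.rowWeights x Q).deltaVertex l b r (decide (w.m 0 = c)) •
        F.wedgeSpin c b (rowOp c l (Finsupp.single (if w.m 0 = c then w.tail else w) 1))

variable {x Q}

theorem rowOp_zero_none : F.rowOp x Q 0 none = 1 := if_pos rfl

theorem rowOp_zero_some (a : ZMod n) : F.rowOp x Q 0 (some a) = 0 := if_neg nofun

theorem rowOp_succ_wedgeSpin {c : ℕ} (r : DecoratedSpin n) (b' : Bool) :
    ∀ v ∈ firstLT K c, F.rowOp x Q (c + 1) r (F.wedgeSpin c b' v) =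
      ∑ l, ∑ b, (F.rowWeights x Q).deltaVertex l b r b' • F.wedgeSpin c b (F.rowOp x Q c l v) := by
  have rowOp_single (w : NormalWedge) : F.rowOp x Q (c + 1) r (Finsupp.single w 1) =
      ∑ l, ∑ b, (F.rowWeights x Q).deltaVertex l b r (decide (w.m 0 = c)) •
        F.wedgeSpin c b (F.rowOp x Q c l (Finsupp.single (if w.m 0 = c then w.tail else w) 1)) := by
    simp [rowOp]
  suffices ∀ v ∈ firstLT K c, (F.rowOp x Q (c + 1) r * F.wedgeSpin c b') v =
      (∑ l, ∑ b, (F.rowWeights x Q).deltaVertex l b r b' •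
        (F.wedgeSpin c b * F.rowOp x Q c l)) v by
    simpa only [Module.End.mul_apply, LinearMap.sum_apply, LinearMap.smul_apply] using this
  refine eqOn_firstLT fun w hw => ?_
  simp only [Module.End.mul_apply, LinearMap.sum_apply, LinearMap.smul_apply]
  cases b' with
  | false => simpa [hw.ne, wedgeSpin] using rowOp_single w
  | true =>
    have cons_zero : (w.cons c hw).m 0 = c := rfl
    have tail_cons : (w.cons c hw).tail = w := rfl
    simpa [wedgeSpin, F.wedge_single_of_lt hw, cons_zero, tail_cons] using
      rowOp_single (w.cons c hw)

theorem rowOp_succ_none {c : ℕ} {v : FockSpace K} (hv : v ∈ firstLT K c) :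
    F.rowOp x Q (c + 1) none v = F.rowOp x Q c none v := by
  have := F.rowOp_succ_wedgeSpin (x := x) (Q := Q) none false v hv
  simpa [Fintype.sum_option, wedgeSpin, BoltzmannWeights.deltaVertex, rowWeights] using this

theorem rowOp_succ_some {c : ℕ} (a : ZMod n) {v : FockSpace K} (hv : v ∈ firstLT K c) :
    F.rowOp x Q (c + 1) (some a) v = x a • F.rowOp x Q c (some (a + 1)) v +
      if a = 0 then F.wedge c (F.rowOp x Q c none v) else 0 := by
  have := F.rowOp_succ_wedgeSpin (x := x) (Q := Q) (some a) false v hv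
  simpa [Fintype.sum_option, wedgeSpin, BoltzmannWeights.deltaVertex, rowWeights, add_comm] using
    this

theorem rowOp_succ_none_wedge {c : ℕ} {v : FockSpace K} (hv : v ∈ firstLT K c) :
    F.rowOp x Q (c + 1) none (F.wedge c v) = F.wedge c (F.rowOp x Q c none v) +
      ((1 - Q) * x 0) • F.rowOp x Q c (some 1) v := by
  have := F.rowOp_succ_wedgeSpin (x := x) (Q := Q) none true v hv
  simpa [Fintype.sum_option, wedgeSpin, BoltzmannWeights.deltaVertex, rowWeights] using this

theorem rowOp_succ_some_wedge {c : ℕ} (a : ZMod n) {v : FockSpace K} (hv : v ∈ firstLT K c) :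
    F.rowOp x Q (c + 1) (some a) (F.wedge c v) =
      F.crossWeight x Q a • F.wedge c (F.rowOp x Q c (some (a + 1)) v) := by
  have := F.rowOp_succ_wedgeSpin (x := x) (Q := Q) (some a) true v hv
  simpa [Fintype.sum_option, wedgeSpin, BoltzmannWeights.deltaVertex, rowWeights] using this

theorem rowOp_mem_spinSpan {c : ℕ} (r : DecoratedSpin n) {v : FockSpace K}
    (hv : v ∈ F.spinSpan c) : F.rowOp x Q c r v ∈ F.spinSpan c := by
  suffices F.spinSpan c ≤ (F.spinSpan c).comap (F.rowOp x Q c r) from this hv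
  clear hv
  induction c generalizing r with
  | zero =>
    cases r with
    | none => exact F.rowOp_zero_none.symm ▸ le_rfl
    | some a => exact fun v _ => by simp [rowOp_zero_some]
  | succ c ih =>
    refine F.spinSpan_succ_le fun b' v hv => ?_
    rw [Submodule.mem_comap, F.rowOp_succ_wedgeSpin r b' v (F.spinSpan_le_firstLT c hv)]
    exact Submodule.sum_mem _ fun l _ => Submodule.sum_mem _ fun b _ =>
      Submodule.smul_mem _ _ (F.wedgeSpin_mem_spinSpan c b (ih l hv))

theorem rowOp_mem_firstLT {c : ℕ} (r : DecoratedSpin n) {v : FockSpace K}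
    (hv : v ∈ F.spinSpan c) : F.rowOp x Q c r v ∈ firstLT K c :=
  F.spinSpan_le_firstLT c (F.rowOp_mem_spinSpan r hv)

theorem rowOp_succ_some_exchange (hQ : ∀ a : ZMod n, a ≠ 0 → F.g a * F.g (-a) = Q) {c : ℕ}
    {a : ZMod n} (ha : a ≠ 0) : ∀ v ∈ F.spinSpan (c + 1),
    F.g (-a) • F.rowOp x Q (c + 1) (some a) (F.wedge c v) =
      Q • F.wedge c (F.rowOp x Q (c + 1) (some a) v) := by
  refine F.eqOn_spinSpan_succ (f := F.g (-a) • (F.rowOp x Q (c + 1) (some a) * F.wedge c))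
    (g := Q • (F.wedge c * F.rowOp x Q (c + 1) (some a))) (fun v hv => ?_) fun v hv => ?_
  all_goals
    have hv' := F.spinSpan_le_firstLT c hv
    simp only [LinearMap.smul_apply, Module.End.mul_apply]
  · rw [F.rowOp_succ_some_wedge a hv', F.rowOp_succ_some a hv', if_neg ha, add_zero, map_smul,
      crossWeight, if_neg ha, ← hQ a ha]
    module
  · rw [F.wedge_wedge_self_of_mem hv', F.rowOp_succ_some_wedge a hv', map_smul,
      F.wedge_wedge_self_of_mem (F.rowOp_mem_firstLT _ hv)]
    simp

theorem rowOp_some_exchange (hQ : ∀ a : ZMod n, a ≠ 0 → F.g a * F.g (-a) = Q) {c b : ℕ} {s : ℤ}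
    (hb : 0 < b) (hs0 : c - 1 - n + b < s) (hs1 : s ≤ c - 1) : ∀ v ∈ F.spinSpan c,
    F.g ((s - c + 1 - b : ℤ) : ZMod n) • F.rowOp x Q c (some b) (F.wedge s v) =
      Q • F.wedge s (F.rowOp x Q c (some b) v) := by
  induction c generalizing b with
  | zero => simp [rowOp_zero_some]
  | succ c ih =>
    push_cast at hs0 hs1
    have hb0 := natCast_ne_zero_of_lt hb (by omega : b < n)
    have charge_eq : ((s - (c + 1 : ℕ) + 1 - b : ℤ) : ZMod n) = s - c - b := by
      push_cast
      ring
    rw [charge_eq]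
    rcases eq_or_ne s c with rfl | hsc
    · simpa using F.rowOp_succ_some_exchange hQ hb0
    replace hsc : s < c := by omega
    have ih_wedge {v} (hv : v ∈ F.spinSpan c) := ih (b := b + 1) (by omega) (by push_cast; omega)
      (by omega) v hv
    have charge_eq' : ((s - c + 1 - (b + 1 : ℕ) : ℤ) : ZMod n) = s - c - b := by
      push_cast
      ring
    rw [charge_eq', Nat.cast_succ] at ih_wedge
    refine F.eqOn_spinSpan_succ
      (f := ((F.g (s - c - b) : K)) • (F.rowOp x Q (c + 1) (some b) * F.wedge s))
      (g := Q • (F.wedge s * F.rowOp x Q (c + 1) (some b))) (fun v hv => ?_) fun v hv => ?_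
    all_goals
      have hv' := F.spinSpan_le_firstLT c hv
      simp only [LinearMap.smul_apply, Module.End.mul_apply]
    · rw [F.rowOp_succ_some b hv', F.rowOp_succ_some b (F.wedge_mem_firstLT hsc hv'),
        if_neg hb0, if_neg hb0, add_zero, add_zero, map_smul, smul_comm, ih_wedge hv, smul_comm]
    · rw [F.wedge_wedge_of_lt_add hsc (by omega) hv', map_smul,
        F.rowOp_succ_some_wedge b (F.wedge_mem_firstLT hsc hv'), F.rowOp_succ_some_wedge b hv',
        map_smul, F.wedge_wedge_of_lt_add hsc (by omega) (F.rowOp_mem_firstLT _ hv)]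
      have ih_wedge_wedge := congrArg (F.wedge c) (ih_wedge hv)
      simp only [map_smul] at ih_wedge_wedge
      linear_combination (norm := module)
        (F.g ((s - c : ℤ) : ZMod n) * F.crossWeight x Q b) • ih_wedge_wedge

theorem one_sub_smul_rowOp_succ_some_zero {c : ℕ} : ∀ v ∈ F.spinSpan (c + 1),
    (1 - Q) • F.rowOp x Q (c + 1) (some 0) v =
      F.rowOp x Q (c + 1) none (F.wedge c v) - Q • F.wedge c (F.rowOp x Q (c + 1) none v) := by
  refine F.eqOn_spinSpan_succ (f := (1 - Q) • F.rowOp x Q (c + 1) (some 0))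
    (g := F.rowOp x Q (c + 1) none * F.wedge c - Q • (F.wedge c * F.rowOp x Q (c + 1) none))
    (fun v hv => ?_) fun v hv => ?_
  all_goals
    have hv' := F.spinSpan_le_firstLT c hv
    simp only [LinearMap.smul_apply, LinearMap.sub_apply, Module.End.mul_apply]
  · rw [F.rowOp_succ_none_wedge hv', F.rowOp_succ_none hv', F.rowOp_succ_some 0 hv', if_pos rfl,
      zero_add]
    module
  · rw [F.wedge_wedge_self_of_mem hv', map_zero, F.rowOp_succ_none_wedge hv',
      F.rowOp_succ_some_wedge 0 hv', map_add,
      F.wedge_wedge_self_of_mem (F.rowOp_mem_firstLT _ hv), map_smul, crossWeight, if_pos rfl,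
      zero_add]
    module

theorem rowOp_succ_none_wedge_wedge_sub (hQ : ∀ a : ZMod n, a ≠ 0 → F.g a * F.g (-a) = Q) {c : ℕ}
    {s : ℤ} (hs0 : c - n < s) (hs1 : s < c) {v : FockSpace K} (hv : v ∈ F.spinSpan c) :
    F.rowOp x Q (c + 1) none (F.wedge s (F.wedge c v)) -
        Q • F.wedge s (F.rowOp x Q (c + 1) none (F.wedge c v)) =
      F.g (s - c) •
        F.wedge c (F.rowOp x Q c none (F.wedge s v) - Q • F.wedge s (F.rowOp x Q c none v)) := by
  have hv' := F.spinSpan_le_firstLT c hv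
  have wedge_exchange {u} (hu : u ∈ firstLT K c) : F.wedge s (F.wedge c u) =
      F.g (s - c) • F.wedge c (F.wedge s u) := by
    simpa using F.wedge_wedge_of_lt_add hs1 (by omega) hu
  have row_exchange : F.g (s - c) • F.rowOp x Q c (some 1) (F.wedge s v) =
      Q • F.wedge s (F.rowOp x Q c (some 1) v) := by
    simpa using F.rowOp_some_exchange (x := x) hQ (b := 1) (s := s) one_pos
      (by push_cast; omega) (by omega) v hv
  rw [wedge_exchange hv', map_smul, F.rowOp_succ_none_wedge (F.wedge_mem_firstLT hs1 hv'),
    F.rowOp_succ_none_wedge hv', map_add, wedge_exchange (F.rowOp_mem_firstLT _ hv),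
    map_smul, map_sub, map_smul]
  linear_combination (norm := module) ((1 - Q) * x 0) • row_exchange

theorem one_sub_smul_rowOp_some (hQ : ∀ a : ZMod n, a ≠ 0 → F.g a * F.g (-a) = Q) {c a : ℕ}
    (ha : 0 < a) (han : a ≤ n) : ∀ v ∈ F.spinSpan c,
    (1 - Q) • F.rowOp x Q c (some a) v =
      (∏ b ∈ Finset.Ico a n, x b) • (F.rowOp x Q c none (F.wedge (c - 1 - n + a) v) -
        Q • F.wedge (c - 1 - n + a) (F.rowOp x Q c none v)) := by
  induction c generalizing a with
  | zero =>
    refine F.spinSpan_zero_le (S := LinearMap.eqLocus ((1 - Q) • F.rowOp x Q 0 (some a))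
      ((∏ b ∈ Finset.Ico a n, x b) • (F.rowOp x Q 0 none * F.wedge ((0 : ℕ) - 1 - n + a) -
        Q • (F.wedge ((0 : ℕ) - 1 - n + a) * F.rowOp x Q 0 none)))) ?_
    have wedge_eq_zero : F.wedge (-1 - n + a) (Finsupp.single NormalWedge.vac 1) = 0 :=
      F.wedge_vacuum NormalWedge.isVacuum_vac (by rw [NormalWedge.vac_m]; push_cast; omega)
    simp [rowOp_zero_some, rowOp_zero_none, wedge_eq_zero]
  | succ c ih =>
    rw [show ((c + 1 : ℕ) : ℤ) - 1 - n + a = c - n + a by push_cast; ring]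
    rcases han.eq_or_lt with rfl | han
    · simpa using F.one_sub_smul_rowOp_succ_some_zero
    have ha0 := natCast_ne_zero_of_lt ha han
    have hlt : (c : ℤ) - n + a < c := by omega
    have ih_wedge {v} (hv : v ∈ F.spinSpan c) := ih (a := a + 1) (by omega) han v hv
    rw [show (c : ℤ) - 1 - n + (a + 1 : ℕ) = c - n + a by push_cast; ring, Nat.cast_succ]
      at ih_wedge
    rw [Finset.prod_eq_prod_Ico_succ_bot han]
    refine F.eqOn_spinSpan_succ (f := (1 - Q) • F.rowOp x Q (c + 1) (some a))
      (g := (x a * ∏ b ∈ Finset.Ico (a + 1) n, x b) •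
        (F.rowOp x Q (c + 1) none * F.wedge (c - n + a) -
          Q • (F.wedge (c - n + a) * F.rowOp x Q (c + 1) none)))
      (fun v hv => ?_) fun v hv => ?_
    all_goals
      have hv' := F.spinSpan_le_firstLT c hv
      simp only [LinearMap.smul_apply, Module.End.mul_apply, LinearMap.sub_apply]
    · rw [F.rowOp_succ_some _ hv', if_neg ha0, add_zero, F.rowOp_succ_none hv',
        F.rowOp_succ_none (F.wedge_mem_firstLT hlt hv'), smul_comm, ih_wedge hv, smul_smul]
    · have charge_eq : (((c - n + a : ℤ) : ZMod n) - c) = a := by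
        push_cast
        simp
      rw [F.rowOp_succ_none_wedge_wedge_sub hQ (by omega) hlt hv, F.rowOp_succ_some_wedge _ hv',
        charge_eq, crossWeight, if_neg ha0, smul_comm, ← map_smul, ih_wedge hv, map_smul]
      module

theorem prod_zmod_eq_prod_range {E : Type*} [CommMonoid E] (x : ZMod n → E) :
    ∏ a, x a = ∏ b ∈ Finset.range n, x b := by
  symm
  refine Finset.prod_bij (fun b _ => (b : ZMod n)) (fun _ _ => Finset.mem_univ _) ?_ ?_
    fun _ _ => rfl
  · intro a ha b hb hab
    rw [Finset.mem_range] at ha hb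
    rwa [ZMod.natCast_eq_natCast_iff', Nat.mod_eq_of_lt ha, Nat.mod_eq_of_lt hb] at hab
  · exact fun b _ => ⟨b.val, by simpa using ZMod.val_lt b, ZMod.natCast_zmod_val b⟩

theorem rowOp_none_exchange (hQ : ∀ a : ZMod n, a ≠ 0 → F.g a * F.g (-a) = Q) {c : ℕ}
    {v : FockSpace K} (hv : v ∈ F.spinSpan c) :
    F.rowOp x Q (c + 1) none (F.wedge c v) = F.wedge c (F.rowOp x Q c none v) +
      (∏ a, x a) • (F.rowOp x Q c none (F.wedge (c - n) v) -
        Q • F.wedge (c - n) (F.rowOp x Q c none v)) := by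
  have hn : 0 < n := NeZero.pos n
  have rowOp_some_one := F.one_sub_smul_rowOp_some (x := x) hQ (c := c) one_pos hn v hv
  rw [show (c : ℤ) - 1 - n + (1 : ℕ) = c - n by push_cast; ring, Nat.cast_one] at rowOp_some_one
  rw [F.rowOp_succ_none_wedge (F.spinSpan_le_firstLT c hv), mul_comm, mul_smul, rowOp_some_one,
    smul_smul, prod_zmod_eq_prod_range, Finset.range_eq_Ico, Finset.prod_eq_prod_Ico_succ_bot hn,
    Nat.cast_zero, zero_add]

theorem rowOp_none_eq_hamiltonianExp [CharZero K]
    (hQ : ∀ a : ZMod n, a ≠ 0 → F.g a * F.g (-a) = Q) {θ π : K} (hθ : θ = ∏ a, x a)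
    (hπ : π = Q * θ) (c : ℕ) : ∀ v ∈ F.spinSpan c,
    F.rowOp x Q c none v = F.hamiltonianExp (fun k => θ ^ k / k - π ^ k / k) v := by
  set E := F.hamiltonianExp fun k => θ ^ k / k - π ^ k / k
  have hn : (0 : ℤ) < n := Int.natCast_pos.2 (NeZero.pos n)
  induction c with
  | zero =>
    refine F.spinSpan_zero_le (S := LinearMap.eqLocus (F.rowOp x Q 0 none) E) ?_
    rw [LinearMap.mem_eqLocus, rowOp_zero_none, Module.End.one_apply,
      F.hamiltonianExp_vacuum _ NormalWedge.isVacuum_vac]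
  | succ c ih =>
    refine F.eqOn_spinSpan_succ (fun v hv => ?_) fun v hv => ?_
    · rw [F.rowOp_succ_none (F.spinSpan_le_firstLT c hv), ih v hv]
    · have exp_wedge_sub : E (F.wedge c v - θ • F.wedge (c - n) v) =
          F.wedge c (E v) - π • F.wedge (c - n) (E v) := F.hamiltonianExp_wedge_sub θ π c v
      rw [map_sub, map_smul, hπ] at exp_wedge_sub
      rw [F.rowOp_none_exchange hQ hv, ih v hv, ih _ (F.wedge_mem_spinSpan (by omega) hv), ← hθ]
      linear_combination (norm := module) -exp_wedge_sub

end MetaplecticData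

/-! ## Sums over paths -/

/-- The sum over all paths from `a` to `b` with `k` steps of the products of the weights of the
steps. -/
def pathSum {α R : Type*} [Fintype α] [DecidableEq α] [CommSemiring R] {k : ℕ}
    (w : Fin k → α → α → R) (a b : α) : R :=
  ∑ f : Fin (k + 1) → α with f 0 = a ∧ f (Fin.last k) = b,
    ∏ i, w i (f i.castSucc) (f i.succ)

section PathSum

variable {α R : Type*} [Fintype α] [DecidableEq α] [CommSemiring R]

theorem pathSum_zero (w : Fin 0 → α → α → R) (a b : α) :
    pathSum w a b = if a = b then 1 else 0 := by
  have paths_eq : (Finset.univ.filter fun f : Fin 1 → α => f 0 = a ∧ f (Fin.last 0) = b) =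
      if a = b then {fun _ => a} else ∅ := by
    ext f
    have f_eq : f = fun _ => f 0 := funext fun i => congrArg f (Subsingleton.elim i 0)
    rw [f_eq]
    split_ifs <;> simp [funext_iff] <;> grind
  rw [pathSum, paths_eq]
  split_ifs <;> simp

theorem pathSum_succ {k : ℕ} (w : Fin (k + 1) → α → α → R) (a b : α) :
    pathSum w a b = ∑ c, w 0 a c * pathSum (fun i => w i.succ) c b := by
  simp only [pathSum, Finset.mul_sum, Finset.sum_filter]
  rw [Finset.sum_comm, ← (Fin.consEquiv fun _ => α).sum_comp, Fintype.sum_prod_type,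
    Finset.sum_comm]
  refine Finset.sum_congr rfl fun f _ => ?_
  rw [Finset.sum_eq_single a, Finset.sum_eq_single (f 0)]
  · simp only [Fin.consEquiv, Equiv.coe_fn_mk, Fin.cons_zero, true_and, Fin.prod_univ_succ,
      ← Fin.succ_last, Fin.cons_succ, Fin.castSucc_zero, ← Fin.succ_castSucc, mul_ite, mul_zero]
  · exact fun c _ hc => by rw [if_neg fun h => hc h.1.symm, mul_zero]
  · simp
  · exact fun c _ hc => if_neg fun h => hc h.1
  · simp

theorem pathSum_succ_last {k : ℕ} (w : Fin (k + 1) → α → α → R) (a b : α) :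
    pathSum w a b = ∑ c, pathSum (fun i => w i.castSucc) a c * w (Fin.last k) c b := by
  induction k generalizing a with
  | zero => simp [pathSum_succ, pathSum_zero]
  | succ k ih =>
    rw [pathSum_succ]
    simp only [ih, Finset.mul_sum, pathSum_succ (fun i : Fin (k + 1) => w i.castSucc),
      Finset.sum_mul]
    rw [Finset.sum_comm]
    refine Finset.sum_congr rfl fun d _ => Finset.sum_congr rfl fun c _ => ?_
    simp only [Fin.succ_last, Fin.succ_castSucc, Fin.castSucc_zero, mul_assoc]

end PathSum

/-! ## Rows of the lattice model -/

/-- A weight for every vertex, given by its left, top, right and bottom spins. -/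
abbrev VertexWeights (n : ℕ) (R : Type*) := DecoratedSpin n → Bool → DecoratedSpin n → Bool → R

/-- The vertex weights `V` arise from `W` by the relabelling `τ` of charges, a factor `A` for every
vertex, a factor `B` for every spin `-` at the bottom, and a factor `ε` which is moved from the left
to the right end of every horizontal edge with spin `-`. -/
def VertexWeights.IsGauge {n : ℕ} {R : Type*} [CommSemiring R] (V W : VertexWeights n R)
    (A B ε : R) (τ : ZMod n ≃ ZMod n) : Prop :=
  ∀ l b r b', ε ^ l.isSome.toNat * V l b r b' =
    A * B ^ b'.toNat * (ε ^ r.isSome.toNat * W (l.map τ) b (r.map τ) b')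

/-- The partition function of a row with columns `0, …, c - 1`, bottom spins `β` and top spins `ν`,
with spin `+` on the left and `r` on the right boundary. -/
def rowSum {n : ℕ} [NeZero n] {R : Type*} [CommSemiring R] (V : VertexWeights n R) {c : ℕ}
    (β ν : Fin c → Bool) (r : DecoratedSpin n) : R :=
  pathSum (fun j l r => V l (ν j) r (β j)) none r

section RowSum

variable {n : ℕ} [NeZero n] {R : Type*} [CommSemiring R]

theorem rowSum_succ (V : VertexWeights n R) {c : ℕ} (β ν : Fin (c + 1) → Bool)
    (r : DecoratedSpin n) :
    rowSum V β ν r = ∑ l, rowSum V (fun j => β j.castSucc) (fun j => ν j.castSucc) l *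
      V l (ν (Fin.last c)) r (β (Fin.last c)) :=
  pathSum_succ_last _ _ _

theorem VertexWeights.IsGauge.rowSum_eq {V W : VertexWeights n R} {A B ε : R}
    {τ : ZMod n ≃ ZMod n} (hV : V.IsGauge W A B ε τ) {c : ℕ} (β ν : Fin c → Bool)
    (r : DecoratedSpin n) :
    rowSum V β ν r =
      A ^ c * B ^ countSpins β * (ε ^ r.isSome.toNat * rowSum W β ν (r.map τ)) := by
  induction c generalizing r with
  | zero => cases r <;> simp [rowSum, pathSum_zero, countSpins]
  | succ c ih =>
    rw [rowSum_succ, rowSum_succ, ← (Equiv.optionCongr τ).sum_comp (fun l => rowSum W _ _ l * _),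
      Finset.mul_sum, Finset.mul_sum]
    refine Finset.sum_congr rfl fun l _ => ?_
    set a := A ^ c * B ^ countSpins fun j => β j.castSucc with a_def
    set w := rowSum W (fun j => β j.castSucc) (fun j => ν j.castSucc) (l.map τ)
    calc rowSum V (fun j => β j.castSucc) (fun j => ν j.castSucc) l *
          V l (ν (Fin.last c)) r (β (Fin.last c))
        = a * w * (ε ^ l.isSome.toNat * V l (ν (Fin.last c)) r (β (Fin.last c))) := by
          rw [ih]
          ring
      _ = _ := by
          rw [hV, countSpins_succ, Equiv.optionCongr_apply, a_def]
          ring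

end RowSum

theorem BoltzmannWeights.countSpins_eq_of_rowSum_ne_zero {n : ℕ} [NeZero n] {K : Type*} [Field K]
    (W : BoltzmannWeights n K) {c : ℕ} {β ν : Fin c → Bool} {r : DecoratedSpin n}
    (hne : rowSum W.deltaVertex β ν r ≠ 0) : countSpins ν = countSpins β + r.isSome.toNat := by
  have conserve (l b r b') (hne : W.deltaVertex l b r b' ≠ 0) :
      l.isSome.toNat + b.toNat = b'.toNat + r.isSome.toNat := by
    rcases l with _ | l <;> rcases r with _ | r <;> cases b <;> cases b' <;>
      simp_all [deltaVertex]
  induction c generalizing r with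
  | zero =>
    rw [rowSum, pathSum_zero] at hne
    obtain rfl : none = r := by simpa using hne
    simp [countSpins]
  | succ c ih =>
    rw [rowSum_succ] at hne
    obtain ⟨l, -, hl⟩ := Finset.exists_ne_zero_of_sum_ne_zero hne
    have left_eq := ih (left_ne_zero_of_mul hl)
    have last_eq := conserve _ _ _ _ (right_ne_zero_of_mul hl)
    rw [countSpins_succ, countSpins_succ]
    omega

namespace MetaplecticData

variable {n : ℕ} {K : Type*} [Field K] (F : MetaplecticData n K) [NeZero n]

theorem sum_rowSum_smul_spinWedge (x : ZMod n → K) (Q : K) {c : ℕ} (β : Fin c → Bool)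
    (r : DecoratedSpin n) :
    ∑ ν, rowSum (F.rowWeights x Q).deltaVertex β ν r • F.spinWedge c ν =
      F.rowOp x Q c r (F.spinWedge c β) := by
  induction c generalizing r with
  | zero => cases r <;> simp [rowSum, pathSum_zero, rowOp_zero_none, rowOp_zero_some, spinWedge]
  | succ c ih =>
    rw [spinWedge, F.rowOp_succ_wedgeSpin r _ _
      (F.spinSpan_le_firstLT c (F.spinWedge_mem_spinSpan c _))]
    calc ∑ ν, rowSum (F.rowWeights x Q).deltaVertex β ν r • F.spinWedge (c + 1) ν
        = ∑ b, ∑ ν : Fin c → Bool, rowSum (F.rowWeights x Q).deltaVertex β (Fin.snoc ν b) r •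
            F.spinWedge (c + 1) (Fin.snoc ν b) := by
          rw [← (Fin.snocEquiv fun _ => Bool).sum_comp, Fintype.sum_prod_type]
          rfl
      _ = ∑ b, ∑ l, ∑ ν : Fin c → Bool,
            (F.rowWeights x Q).deltaVertex l b r (β (Fin.last c)) •
              rowSum (F.rowWeights x Q).deltaVertex (fun j => β j.castSucc) ν l •
                F.wedgeSpin c b (F.spinWedge c ν) := by
          refine Finset.sum_congr rfl fun b _ => ?_
          rw [Finset.sum_comm]
          simp only [rowSum_succ, spinWedge, Fin.snoc_castSucc, Fin.snoc_last, Finset.sum_smul,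
            smul_smul, mul_comm]
      _ = _ := by
          rw [Finset.sum_comm]
          simp only [← ih, map_sum, map_smul, Finset.smul_sum]

variable [CharZero K]

theorem sum_pathSum_smul_eq_hamiltonianExp {α : Type*} [Fintype α] [DecidableEq α]
    (e : α → FockSpace K) (p : α → Prop) {N : ℕ} (T : Fin N → α → α → K) (t : Fin N → K)
    (s : Fin N → ℕ → K) (hp : ∀ i a b, p a → T i a b ≠ 0 → p b)
    (hT : ∀ i a, p a → ∑ b, T i a b • e b = t i • F.hamiltonianExp (s i) (e a)) {a : α}
    (ha : p a) :
    ∑ b, pathSum T a b • e b = (∏ i, t i) • F.hamiltonianExp (∑ i, s i) (e a) := by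
  induction N generalizing a with
  | zero => simp [pathSum_zero, hamiltonianExp_zero]
  | succ N ih =>
    set t' := ∏ i : Fin N, t i.succ
    set s' := ∑ i : Fin N, s i.succ
    have ih_smul (c : α) : T 0 a c • ∑ b, pathSum (fun i => T i.succ) c b • e b =
        t' • F.hamiltonianExp s' (T 0 a c • e c) := by
      by_cases hc : T 0 a c = 0
      · simp [hc]
      · rw [ih _ _ _ (fun i => hp i.succ) (fun i => hT i.succ) (hp 0 a c ha hc), map_smul,
          smul_comm]
    calc ∑ b, pathSum T a b • e b
        = ∑ c, T 0 a c • ∑ b, pathSum (fun i => T i.succ) c b • e b := by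
          simp only [pathSum_succ, Finset.sum_smul, Finset.smul_sum, mul_smul]
          exact Finset.sum_comm
      _ = t' • F.hamiltonianExp s' (∑ c, T 0 a c • e c) := by
          simp only [ih_smul, map_sum, Finset.smul_sum]
      _ = _ := by
          rw [hT 0 a ha, map_smul, smul_smul, Fin.prod_univ_succ, Fin.sum_univ_succ, add_comm (s 0),
            hamiltonianExp_add, mul_comm, Module.End.mul_apply]

theorem pathSum_rowSum_eq_superLLT {N M ℓ : ℕ} {V : Fin N → VertexWeights n K}
    {A B ε Q θ π : Fin N → K} {x : Fin N → ZMod n → K} {τ : Fin N → ZMod n ≃ ZMod n}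
    (hV : ∀ i, (V i).IsGauge (F.rowWeights (x i) (Q i)).deltaVertex (A i) (B i) (ε i) (τ i))
    (hQ : ∀ i, ∀ a ≠ 0, F.g a * F.g (-a) = Q i) (hθ : ∀ i, θ i = ∏ a, x i a)
    (hπ : ∀ i, π i = Q i * θ i) {lam mu : Fin ℓ → ℕ} (hlam : Antitone lam) (hmu : Antitone mu)
    (hMlam : ∀ i, addRho lam i ≤ M) (hMmu : ∀ i, addRho mu i ≤ M) :
    pathSum (fun i β ν => rowSum (V i) β ν none) (boundarySpins M (addRho lam))
        (boundarySpins M (addRho mu)) =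
      (∏ i, A i ^ (M + 1) * B i ^ ℓ) * superLLT F lam mu hlam hmu θ π := by
  have rowSum_eq (i) (β ν : Fin (M + 1) → Bool) : rowSum (V i) β ν none =
      A i ^ (M + 1) * B i ^ countSpins β *
        rowSum (F.rowWeights (x i) (Q i)).deltaVertex β ν none := by
    simpa using (hV i).rowSum_eq β ν none
  have partition_eq := F.sum_pathSum_smul_eq_hamiltonianExp (F.spinWedge (M + 1))
    (fun β => countSpins β = ℓ) (fun i β ν => rowSum (V i) β ν none)
    (fun i => A i ^ (M + 1) * B i ^ ℓ) (fun i k => θ i ^ k / k - π i ^ k / k)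
    (fun i β ν hβ hne => by
      rw [rowSum_eq] at hne
      simpa [hβ] using
        BoltzmannWeights.countSpins_eq_of_rowSum_ne_zero _ (right_ne_zero_of_mul hne))
    (fun i β hβ => by
      simp only [rowSum_eq, mul_smul, ← Finset.smul_sum, F.sum_rowSum_smul_spinWedge, hβ]
      rw [F.rowOp_none_eq_hamiltonianExp (hQ i) (hθ i) (hπ i) _ _ (F.spinWedge_mem_spinSpan _ _)])
    (countSpins_boundarySpins (addRho_strictAnti hlam) hMlam)
  have exponent_eq : (∑ i, fun k : ℕ => θ i ^ k / (k : K) - π i ^ k / k) =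
      fun k : ℕ => ∑ j, θ j ^ k / (k : K) - ∑ j, π j ^ k / k := by
    ext k
    rw [Finset.sum_apply, Finset.sum_sub_distrib]
  rw [F.spinWedge_boundarySpins (addRho_strictAnti hlam) hMlam, exponent_eq,
    hamiltonianExp_single] at partition_eq
  have coeff_eq := DFunLike.congr_fun partition_eq
    (NormalWedge.ofStrict (addRho mu) (addRho_strictAnti hmu))
  simpa only [superLLT, Finsupp.finsetSum_apply, Finsupp.smul_apply, smul_eq_mul,
    F.spinWedge_apply_ofStrict (addRho_strictAnti hmu) hMmu, mul_ite, mul_one, mul_zero,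
    Finset.sum_ite_eq', Finset.mem_univ, if_true] using coeff_eq

end MetaplecticData

/-! ## The two models -/

theorem sum_boundaryConfigurations_eq_pathSum {n N M ℓ : ℕ} [NeZero n] {K : Type*} [Field K]
    (V : Fin N → VertexWeights n K) (κ ν : Fin ℓ → ℕ) :
    ∑ s ∈ boundaryConfigurations n N M κ ν, ∏ i : Fin N, ∏ c : Fin (M + 1),
      V i (s.horiz i c.castSucc) (s.vert i.succ c) (s.horiz i c.succ) (s.vert i.castSucc c) =
    pathSum (fun i β ν => rowSum (V i) β ν none) (boundarySpins M κ) (boundarySpins M ν) := by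
  have configurations_eq : boundaryConfigurations n N M κ ν =
      (Finset.univ.filter fun f : Fin (N + 1) → Fin (M + 1) → Bool =>
        f 0 = boundarySpins M κ ∧ f (Fin.last N) = boundarySpins M ν) ×ˢ
      Fintype.piFinset fun _ : Fin N => Finset.univ.filter fun g : Fin (M + 2) → DecoratedSpin n =>
        g 0 = none ∧ g (Fin.last (M + 1)) = none := by
    ext s
    rw [boundaryConfigurations, Finset.mem_filter, Finset.mem_product, Finset.mem_filter,
      Fintype.mem_piFinset]
    simp only [Finset.mem_filter, Finset.mem_univ, true_and, and_assoc]
    rfl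
  rw [configurations_eq, Finset.sum_product, pathSum]
  refine Finset.sum_congr rfl fun f _ => ?_
  simp only [rowSum, pathSum]
  rw [Finset.prod_univ_sum]
  rfl

namespace ChargedParams

variable {n N : ℕ} {K : Type*} [Field K]

/-- The parameters whose model `𝔖^q` has the partition functions of the model `𝔖^{*,q}` of `P`. -/
def dual (P : ChargedParams n N K) : ChargedParams n N K where
  x := P.y
  y := P.x
  A i := (P.A i)⁻¹
  B i := (P.B i)⁻¹
  f a := P.h (-a)
  h a := P.f (-a)

variable {P : ChargedParams n N K}

theorem Nondegenerate.dual (hP : P.Nondegenerate) : P.dual.Nondegenerate := by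
  refine ⟨fun i => ?_, fun a => (hP.2 (-a)).symm⟩
  obtain ⟨hx, hy, hA, hB⟩ := hP.1 i
  exact ⟨hy, hx, inv_ne_zero hA, inv_ne_zero hB⟩

theorem generalizedFreeFermionic_dual_iff (hP : P.Nondegenerate) :
    GeneralizedFreeFermionic P.dual.deltaWeights ↔ GeneralizedFreeFermionic P.deltaWeights := by
  rw [← P.gammaWeights_generalizedFreeFermionic_iff hP]
  refine forall_congr' fun i => and_congr ?_ (forall_congr' fun a => imp_congr_right fun _ => ?_)
  · simp only [deltaWeights, gammaWeights, dual, neg_zero]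
    ring_nf
  · simp only [deltaWeights, gammaWeights, dual, neg_zero, neg_neg]
    ring_nf

theorem Nondegenerate.g_eq (hP : P.Nondegenerate) {F : MetaplecticData n K}
    (hF : F.IsFockSpaceOf P.deltaWeights) (i : Fin N) {a : ZMod n} (ha : a ≠ 0) :
    F.g a = P.h a * P.y i / (P.f a * P.x i) := by
  obtain ⟨hx, hy, hA, hB⟩ := hP.1 i
  obtain ⟨hf, hh⟩ := hP.2 a
  rw [← hF i a ha]
  simp only [deltaWeights]
  field_simp

theorem Nondegenerate.isFockSpaceOf_dual (hP : P.Nondegenerate) {F : MetaplecticData n K}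
    (hF : F.IsFockSpaceOf P.deltaWeights) : F.inv.IsFockSpaceOf P.dual.deltaWeights := by
  intro i a ha
  obtain ⟨hx, hy, hA, hB⟩ := hP.1 i
  obtain ⟨hf, hh⟩ := hP.2 (-a)
  rw [F.inv_g, hP.g_eq hF i (neg_ne_zero.2 ha)]
  simp only [deltaWeights, ChargedParams.dual]
  field_simp

theorem Nondegenerate.g_mul_g_neg (hP : P.Nondegenerate)
    (hFF : GeneralizedFreeFermionic P.deltaWeights) {F : MetaplecticData n K}
    (hF : F.IsFockSpaceOf P.deltaWeights) (i : Fin N) {a : ZMod n} (ha : a ≠ 0) :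
    F.g a * F.g (-a) = -(P.h 0 * P.y i / (P.f 0 * P.x i)) := by
  obtain ⟨hx, hy, hA, hB⟩ := hP.1 i
  obtain ⟨hf, -⟩ := hP.2 a
  obtain ⟨hf_neg, -⟩ := hP.2 (-a)
  obtain ⟨hf_zero, -⟩ := hP.2 0
  have charge_condition := (hFF i).2 a ha
  rw [hP.g_eq hF i ha, hP.g_eq hF i (neg_ne_zero.2 ha)]
  simp only [deltaWeights] at charge_condition
  field_simp at charge_condition ⊢
  linear_combination charge_condition

theorem Nondegenerate.crossWeight_eq (hP : P.Nondegenerate) {F : MetaplecticData n K}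
    (hF : F.IsFockSpaceOf P.deltaWeights) (i : Fin N) (a : ZMod n) :
    F.crossWeight (fun a => P.f a * P.x i) (-(P.h 0 * P.y i / (P.f 0 * P.x i))) a =
      P.h a * P.y i := by
  obtain ⟨hx, -⟩ := hP.1 i
  obtain ⟨hf, -⟩ := hP.2 a
  rw [MetaplecticData.crossWeight]
  split_ifs with ha
  · subst ha
    field_simp
  · rw [hP.g_eq hF i ha]
    field_simp

theorem Nondegenerate.isGauge_deltaVertex (hP : P.Nondegenerate) {F : MetaplecticData n K}
    (hF : F.IsFockSpaceOf P.deltaWeights) (i : Fin N) :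
    VertexWeights.IsGauge (P.deltaWeights i).deltaVertex
      (F.rowWeights (fun a => P.f a * P.x i)
        (-(P.h 0 * P.y i / (P.f 0 * P.x i)))).deltaVertex (P.A i) (P.B i) 1 (Equiv.refl _) := by
  obtain ⟨hx, -⟩ := hP.1 i
  obtain ⟨hf_zero, -⟩ := hP.2 0
  have c₁_eq : (P.f 0 * P.x i + P.h 0 * P.y i) * P.A i * P.B i =
      P.A i * P.B i * ((1 + P.h 0 * P.y i / (P.f 0 * P.x i)) * (P.f 0 * P.x i)) := by
    field_simp
  rintro (_ | l) (_ | _) (_ | r) (_ | _) <;>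
    simp [BoltzmannWeights.deltaVertex, deltaWeights, MetaplecticData.rowWeights,
      hP.crossWeight_eq hF, c₁_eq]
  all_goals split_ifs <;> ring

/-- Reflecting the charges by `a ↦ 1 - a` turns the vertices of `𝔖^{*,q}`, read upside down, into
those of `𝔖^q`. -/
theorem isGauge_gammaVertex (P : ChargedParams n N K) (i : Fin N) :
    VertexWeights.IsGauge (fun l b r b' => (P.gammaWeights i).gammaVertex l b' r b)
      (P.dual.deltaWeights i).deltaVertex 1 1 (P.f 0 * P.x i + P.h 0 * P.y i)
      (Equiv.subLeft 1) := by
  have charge_iff (l r : ZMod n) : 1 - l = 1 - r + 1 ↔ r = l + 1 := by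
    constructor <;> intro h <;> linear_combination h
  have zero_iff (r : ZMod n) : 1 - r = 0 ↔ r = 1 := by rw [sub_eq_zero, eq_comm]
  rintro (_ | l) (_ | _) (_ | r) (_ | _) <;>
    simp [BoltzmannWeights.deltaVertex, BoltzmannWeights.gammaVertex, deltaWeights, gammaWeights,
      dual, charge_iff, zero_iff]
  case some.false.none.true => split_ifs <;> ring
  all_goals split_ifs with h <;> simp only [h, add_sub_cancel_right]

theorem theta_eq_prod [NeZero n] (P : ChargedParams n N K) (i : Fin N) :
    P.theta i = ∏ a, P.f a * P.x i := by
  rw [Finset.prod_mul_distrib, Finset.prod_const, Finset.card_univ, ZMod.card, theta, mul_comm]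

theorem Nondegenerate.pi_eq [NeZero n] (hP : P.Nondegenerate) (i : Fin N) :
    P.pi i = -(P.h 0 * P.y i / (P.f 0 * P.x i)) * P.theta i := by
  obtain ⟨hx, -⟩ := hP.1 i
  obtain ⟨hf_zero, -⟩ := hP.2 0
  rw [pi, theta, ← pow_sub_one_mul (NeZero.ne n) (P.x i)]
  field_simp

theorem theta_dual [NeZero n] (P : ChargedParams n N K) : P.dual.theta = P.eta := by
  ext i
  rw [theta, eta, ← Equiv.prod_comp (Equiv.neg (ZMod n)) P.h]
  rfl

theorem pi_dual [NeZero n] (P : ChargedParams n N K) : P.dual.pi = P.tau := by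
  ext i
  rw [pi, tau, ← Equiv.prod_comp (Equiv.neg (ZMod n)) P.h]
  simp only [dual, neg_zero, Equiv.neg_apply]

theorem gammaZ_eq_deltaZ_dual [NeZero n] (P : ChargedParams n N K) (M : ℕ) {ℓ : ℕ}
    (κ ν : Fin ℓ → ℕ) : P.gammaZ M κ ν = P.dual.deltaZ M κ ν := by
  rw [gammaZ, deltaZ, sum_boundaryConfigurations_eq_pathSum
    (fun i l b r b' => (P.gammaWeights i).gammaVertex l b' r b),
    sum_boundaryConfigurations_eq_pathSum]
  congr 1
  ext i β ν
  simpa using (P.isGauge_gammaVertex i).rowSum_eq β ν none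

theorem Nondegenerate.deltaZ_eq_superLLT [NeZero n] [CharZero K] (hP : P.Nondegenerate)
    (hFF : GeneralizedFreeFermionic P.deltaWeights) {F : MetaplecticData n K}
    (hF : F.IsFockSpaceOf P.deltaWeights) {ℓ M : ℕ} {lam mu : Fin ℓ → ℕ} (hlam : Antitone lam)
    (hmu : Antitone mu) (hMlam : ∀ i, addRho lam i ≤ M) (hMmu : ∀ i, addRho mu i ≤ M) :
    P.deltaZ M (addRho lam) (addRho mu) =
      (∏ i, P.A i ^ (M + 1) * P.B i ^ ℓ) * superLLT F lam mu hlam hmu P.theta P.pi := by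
  rw [deltaZ, sum_boundaryConfigurations_eq_pathSum]
  exact F.pathSum_rowSum_eq_superLLT (fun i => hP.isGauge_deltaVertex hF i)
    (fun i _ ha => hP.g_mul_g_neg hFF hF i ha) P.theta_eq_prod hP.pi_eq hlam hmu hMlam hMmu

end ChargedParams

theorem mainTheorem5 {K : Type*} [Field K] [CharZero K] {n N : ℕ} [NeZero n]
    (P : ChargedParams n N K) (hP : P.Nondegenerate)
    (hFF : GeneralizedFreeFermionic P.deltaWeights)
    (F : MetaplecticData n K) (hF : F.IsFockSpaceOf P.deltaWeights)
    {ℓ : ℕ} (lam mu : Fin ℓ → ℕ) (hlam : Antitone lam) (hmu : Antitone mu)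
    (M : ℕ) (hMlam : ∀ i, addRho lam i ≤ M) (hMmu : ∀ i, addRho mu i ≤ M) :
    P.deltaZ M (addRho lam) (addRho mu) =
        (∏ i, P.A i ^ (M + 1) * P.B i ^ ℓ) * superLLT F lam mu hlam hmu P.theta P.pi ∧
      P.gammaZ M (addRho lam) (addRho mu) =
        (∏ i, P.A i ^ (-((M : ℤ) + 1)) * P.B i ^ (-(ℓ : ℤ))) *
          superLLT F.inv lam mu hlam hmu P.eta P.tau := by
  refine ⟨hP.deltaZ_eq_superLLT hFF hF hlam hmu hMlam hMmu, ?_⟩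
  rw [P.gammaZ_eq_deltaZ_dual, hP.dual.deltaZ_eq_superLLT
    ((ChargedParams.generalizedFreeFermionic_dual_iff hP).2 hFF) (hP.isFockSpaceOf_dual hF)
    hlam hmu hMlam hMmu, P.theta_dual, P.pi_dual]
  congr 1
  refine Finset.prod_congr rfl fun i _ => ?_
  rw [zpow_neg, zpow_neg, ← Nat.cast_succ, zpow_natCast, zpow_natCast, ← inv_pow, ← inv_pow]
  rfl
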